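/- Let $k$ be a field of characteristic zero, $n\ge 3$, $k[\mathbf x]=k[x_1,\dots,x_n]$, $\Gamma$ a finitely generated totally ordered $\mathbf Z$-module, and $\mathbf w=(w_1,\dots,w_n)\in\Gamma^n$ with $w_i>0$ for all $i$. For $f\in k[\mathbf x]$ let $\deg f\in\Gamma\cup\{-\infty\}$ be the $\mathbf w$-degree, i.e. the maximum of $\sum_i a_iw_i$ over the monomials $x^a$ occurring in $f$ ($\deg 0=-\infty$), and for $f\neq 0$ let $f^{\mathbf w}$ be the $\mathbf w$-homogeneous component of $f$ of degree $\deg f$. For a tuple put $\deg(f_1,\dots,f_l)=\sum_i\deg f_i$. For a differential form $\omega=\sum_{i_1<\dots<i_l}f_{i_1,\dots,i_l}\,dx_{i_1}\wedge\dots\wedge dx_{i_l}\in\bigwedge^l\Omega_{k[\mathbf x]/k}$ put $\deg\omega=\max\deg(f_{i_1,\dots,i_l}x_{i_1}\cdots x_{i_l})$. For nonzero polynomials, $h_1\approx h_2$ means that $h_1,h_2$ are linearly dependent over $k$. Let $\mathcal T$ be the set of triples $F=(f_1,f_2,f_3)$ of elements of $k[\mathbf x]$ that are algebraically independent over $k$;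 such an $F$ is identified with the $k$-algebra homomorphism $k[y_1,y_2,y_3]\to k[\mathbf x]$, $y_i\mapsto f_i$. For $i\in\{1,2,3\}$ let $\mathcal E_i$ be the set of automorphisms $E$ of $k[y_1,y_2,y_3]$ with $E(y_j)=y_j$ for $j\neq i$ and $E(y_i)=y_i+\phi$ for some polynomial $\phi$ in the variables $y_j$, $j\ne i$. For $\sigma\in\mathfrak S_3$ write $F_\sigma=(f_{\sigma(1)},f_{\sigma(2)},f_{\sigma(3)})$. For $F=(f_1,f_2,f_3)$ and $G=(g_1,g_2,g_3)$ in $\mathcal T$ consider the conditions - (SU1) $g_1=f_1+af_3^2+cf_3$ and $g_2=f_2+bf_3$ for some $a,b,c\in k$, and $g_3-f_3\in k[g_1,g_2]$; - (SU2) $\deg f_1\le\deg g_1$ and $\deg f_2=\deg g_2$; - (SU3) $(g_1^{\mathbf w})^2\approx(g_2^{\mathbf w})^s$ for some odd number $s\ge3$; - (SU4) $\deg f_3\le\deg g_1$ and $f_3^{\mathbf w}\notin k[g_1^{\mathbf w},g_2^{\mathbf w}]$; - (SU5) $\deg g_3<\deg f_3$; - (SU6) $\deg g_3<\deg g_1-\deg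 g_2+\deg dg_1\wedge dg_2$; - (SU1$'$) $g_1-f_1\in k[f_2,f_3]$, $g_2-f_2\in k[f_3]$ and $g_3-f_3\in k[g_1,g_2]$; - (SU2$'$) $\deg f_i\le\deg g_i$ for $i=1,2$; - (SU3$'$) $\deg g_2<\deg g_1$ and $g_1^{\mathbf w}\notin k[g_2^{\mathbf w}]$. The pair $(F,G)$ satisfies the Shestakov-Umirbaev (SU) condition if (SU1)-(SU6) hold, and the quasi Shestakov-Umirbaev (quasi SU) condition if (SU1$'$), (SU2$'$), (SU3$'$), (SU4), (SU5), (SU6) hold. We say that $F\in\mathcal T$ admits an SU reduction (resp. a quasi SU reduction) if there exist $G\in\mathcal T$ and $\sigma\in\mathfrak S_3$ such that $(F_\sigma,G_\sigma)$ satisfies the SU (resp. quasi SU) condition. (i) If $(F,G)$ satisfies the quasi SU condition for $F,G\in\mathcal T$, then there exist $E_1\in\mathcal E_1$ and $E_2\in\mathcal E_2$ with $\deg(G\circ E_1)=\deg G$ such that $G\circ E_1\circ E_2\in\mathcal T$ and $(F,G\circ E_1\circ E_2)$ satisfies the SU condition. (ii) For $F\in\mathcal T$: $F$ admits an SU reduction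 if and only if $F$ admits a quasi SU reduction. -/

import Mathlib

open MvPolynomial

noncomputable section

namespace SU

variable {k : Type*} [Field k] {n : ℕ}
  {Γ : Type*} [AddCommGroup Γ] [LinearOrder Γ]

/-- The `w`-degree of a polynomial in `k[x] = k[x_1, …, x_n]`: the largest `∑ a_i w_i` over the
monomials `x^a` occurring in `f`, and `⊥` (that is, `-∞`) if `f = 0`. -/
def wdeg (w : Fin n → Γ) (f : MvPolynomial (Fin n) k) : WithBot Γ :=
  weightedTotalDegree' w f

/-- The leading form `f^w`: the `w`-homogeneous component of `f` of degree `wdeg w f`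
(and `0` if `f = 0`). -/
def lead (w : Fin n → Γ) (f : MvPolynomial (Fin n) k) : MvPolynomial (Fin n) k :=
  weightedHomogeneousComponent w ((wdeg w f).unbotD 0) f

/-- The `w`-degree of a tuple of polynomials: the sum of the `w`-degrees of its entries. -/
def tupleDeg {l : ℕ} (w : Fin n → Γ) (F : Fin l → MvPolynomial (Fin n) k) : WithBot Γ :=
  ∑ i, wdeg w (F i)

/-- The basis `dx_{i_1} ∧ ⋯ ∧ dx_{i_l}`, `i_1 < ⋯ < i_l`, of the `l`-th exterior power of the
module of Kähler differentials of `k[x]` over `k`. -/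
def formBasis (k : Type*) [Field k] (n l : ℕ) :
    Module.Basis (Set.powersetCard (Fin n) l) (MvPolynomial (Fin n) k)
      (⋀[MvPolynomial (Fin n) k]^l (KaehlerDifferential k (MvPolynomial (Fin n) k))) :=
  (KaehlerDifferential.mvPolynomialBasis k (Fin n)).exteriorPower l

/-- The `w`-degree of a differential `l`-form `ω = ∑ f_{i_1,…,i_l} dx_{i_1} ∧ ⋯ ∧ dx_{i_l}`:
the maximum of the `w`-degrees of the polynomials `f_{i_1,…,i_l} x_{i_1} ⋯ x_{i_l}`. -/
def formDeg {l : ℕ} (w : Fin n → Γ)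
    (ω : ⋀[MvPolynomial (Fin n) k]^l (KaehlerDifferential k (MvPolynomial (Fin n) k))) :
    WithBot Γ :=
  Finset.univ.sup fun s : Set.powersetCard (Fin n) l =>
    wdeg w ((formBasis k n l).repr ω s * ∏ i ∈ (s : Finset (Fin n)), X i)

/-- The 2-form `df ∧ dg`. -/
def dWedge (f g : MvPolynomial (Fin n) k) :
    ⋀[MvPolynomial (Fin n) k]^2 (KaehlerDifferential k (MvPolynomial (Fin n) k)) :=
  exteriorPower.ιMulti (MvPolynomial (Fin n) k) 2
    ![KaehlerDifferential.D k (MvPolynomial (Fin n) k) f,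
      KaehlerDifferential.D k (MvPolynomial (Fin n) k) g]

/-- `h₁ ≈ h₂`: the polynomials `h₁` and `h₂` are linearly dependent over `k`. -/
def Approx (h₁ h₂ : MvPolynomial (Fin n) k) : Prop :=
  ¬ LinearIndependent k ![h₁, h₂]

/-- The set of triples of algebraically independent elements of `k[x]`. The entries
`f_1, f_2, f_3` are `F 0, F 1, F 2`. -/
def triples (k : Type*) [Field k] (n : ℕ) : Set (Fin 3 → MvPolynomial (Fin n) k) :=
  {F | AlgebraicIndependent k F}

/-- An automorphism `E` of `k[y] = k[y_1, y_2, y_3]` is elementary if, for some `l`, it fixes all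
variables other than `y_l` and sends `y_l` to `y_l + φ` with `φ` not involving `y_l`. -/
def IsElementary (E : MvPolynomial (Fin 3) k ≃ₐ[k] MvPolynomial (Fin 3) k) : Prop :=
  ∃ l : Fin 3, ∃ φ ∈ supported k ({l}ᶜ : Set (Fin 3)),
    E (X l) = X l + φ ∧ ∀ i, i ≠ l → E (X i) = X i

/-- The set of elementary automorphisms of `k[y]` fixing every `y_j` with `j ≠ i`. -/
def elementaryAt (k : Type*) [Field k] (i : Fin 3) :
    Set (MvPolynomial (Fin 3) k ≃ₐ[k] MvPolynomial (Fin 3) k) :=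
  {E | IsElementary E ∧ ∀ j, j ≠ i → E (X j) = X j}

/-- The composite `F ∘ E : k[y] → k[x]` as a triple, where the triple `F` is identified with the
`k`-algebra homomorphism `k[y] → k[x]`, `y_i ↦ F i`. -/
def comp (F : Fin 3 → MvPolynomial (Fin n) k)
    (E : MvPolynomial (Fin 3) k ≃ₐ[k] MvPolynomial (Fin 3) k) :
    Fin 3 → MvPolynomial (Fin n) k :=
  fun i => aeval F (E (X i))

/-- The Shestakov-Umirbaev condition for `(F, G)`. In `su6`, stated for triples of
nonzero polynomials, the term `- deg g_2` has been moved to the left. -/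
structure SUCondition (w : Fin n → Γ) (F G : Fin 3 → MvPolynomial (Fin n) k) : Prop where
  su1 : (∃ a b c : k, G 0 = F 0 + C a * F 2 ^ 2 + C c * F 2 ∧ G 1 = F 1 + C b * F 2) ∧
    G 2 - F 2 ∈ Algebra.adjoin k {G 0, G 1}
  su2 : wdeg w (F 0) ≤ wdeg w (G 0) ∧ wdeg w (F 1) = wdeg w (G 1)
  su3 : ∃ s : ℕ, Odd s ∧ 3 ≤ s ∧ Approx (lead w (G 0) ^ 2) (lead w (G 1) ^ s)
  su4 : wdeg w (F 2) ≤ wdeg w (G 0) ∧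
    lead w (F 2) ∉ Algebra.adjoin k {lead w (G 0), lead w (G 1)}
  su5 : wdeg w (G 2) < wdeg w (F 2)
  su6 : wdeg w (G 2) + wdeg w (G 1) < wdeg w (G 0) + formDeg w (dWedge (G 0) (G 1))

/-- The quasi Shestakov-Umirbaev condition for `(F, G)`. -/
structure QuasiSUCondition (w : Fin n → Γ) (F G : Fin 3 → MvPolynomial (Fin n) k) : Prop where
  su1' : G 0 - F 0 ∈ Algebra.adjoin k {F 1, F 2} ∧ G 1 - F 1 ∈ Algebra.adjoin k {F 2} ∧
    G 2 - F 2 ∈ Algebra.adjoin k {G 0, G 1}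
  su2' : wdeg w (F 0) ≤ wdeg w (G 0) ∧ wdeg w (F 1) ≤ wdeg w (G 1)
  su3' : wdeg w (G 1) < wdeg w (G 0) ∧ lead w (G 0) ∉ Algebra.adjoin k {lead w (G 1)}
  su4 : wdeg w (F 2) ≤ wdeg w (G 0) ∧
    lead w (F 2) ∉ Algebra.adjoin k {lead w (G 0), lead w (G 1)}
  su5 : wdeg w (G 2) < wdeg w (F 2)
  su6 : wdeg w (G 2) + wdeg w (G 1) < wdeg w (G 0) + formDeg w (dWedge (G 0) (G 1))

/-- `F` admits a Shestakov-Umirbaev reduction; `F ∘ σ` is the permuted triple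
`F_σ = (f_{σ(1)}, f_{σ(2)}, f_{σ(3)})`. -/
def AdmitsSUReduction (w : Fin n → Γ) (F : Fin 3 → MvPolynomial (Fin n) k) : Prop :=
  ∃ G ∈ triples k n, ∃ σ : Equiv.Perm (Fin 3), SUCondition w (F ∘ σ) (G ∘ σ)

/-- `F` admits a quasi Shestakov-Umirbaev reduction. -/
def AdmitsQuasiSUReduction (w : Fin n → Γ) (F : Fin 3 → MvPolynomial (Fin n) k) : Prop :=
  ∃ G ∈ triples k n, ∃ σ : Equiv.Perm (Fin 3), QuasiSUCondition w (F ∘ σ) (G ∘ σ)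

end SU

end

noncomputable section

namespace SU

variable {k : Type*} [Field k] {n : ℕ}
  {Γ : Type*} [AddCommGroup Γ]

/-! ### Weighted degrees and leading forms. -/

section Degree

variable [LinearOrder Γ]

/-! Write d = deg g_2, e = deg g_1, D = deg dg_1 ∧ dg_2, x = deg f_3. The engine is a
Shestakov-Umirbaev inequality for pairs (`le_wdeg_and_of_cancellation`). Suppose the weighted top
part of Φ(f, Y) vanishes at Y = g^w. Then q deg f = p deg g with p, q coprime, (g^w)^p is a constant
times (f^w)^q, and deg Φ(f, g) ≥ p deg g + deg df ∧ dg - deg f - deg g. To see the inequality,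
differentiate Φ in Y until the top part no longer vanishes. Each derivative costs at most deg f -
deg df ∧ dg, because df ∧ dΦ(f, g) = Φ_Y(f, g) df ∧ dg. The number of derivatives is limited
because, in characteristic zero, a nonzero root has multiplicity below the number of terms.

In the quasi SU situation, f_3 - g_3 = Φ(g_2, g_1) has leading form f_3^w, outside k[g_1^w, g_2^w],
so the top part must cancel. Since x ≤ e and d < e, this forces p = 2, hence q = s odd, s ≥ 3, sd =
2e, and also e + D ≤ x + d and deg dg_2 ∧ df_3 ≥ e + D (`QuasiSUCondition.exists_degrees`). In
particular d < 2x.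

Degrees then restrict the other two differences. The polynomial g_2 - f_2 is affine in f_3, say b
f_3 + e₀. The difference g_1 - f_1 is a polynomial in f_2, f_3; cancellation there would contradict
deg df_2 ∧ df_3 ≥ e + D, so each of its terms has degree at most e < x + d. This leaves φ(f_2) + c
f_3 + a f_3². Finally φ(f_2) is rewritten as ψ(g_2) + c' f_3, and E_1, E_2 subtract ψ(g_2) from g_1
and e₀ from g_2. Because s is odd, deg ψ(g_2) < e, so leading forms and the remaining conditions
survive. The converse in (ii) is elementary: SU implies quasi SU for the same pair. -/

theorem wdeg_le_iff {w : Fin n → Γ} {f : MvPolynomial (Fin n) k} {a : WithBot Γ} :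
    wdeg w f ≤ a ↔ ∀ s, coeff s f ≠ 0 → ((Finsupp.weight w s : Γ) : WithBot Γ) ≤ a := by
  simp [wdeg, weightedTotalDegree', Finset.sup_le_iff]

theorem le_wdeg {w : Fin n → Γ} {f : MvPolynomial (Fin n) k} {s : Fin n →₀ ℕ}
    (hs : coeff s f ≠ 0) : ((Finsupp.weight w s : Γ) : WithBot Γ) ≤ wdeg w f :=
  wdeg_le_iff.1 le_rfl s hs

theorem wdeg_eq_bot {w : Fin n → Γ} {f : MvPolynomial (Fin n) k} : wdeg w f = ⊥ ↔ f = 0 :=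
  weightedTotalDegree'_eq_bot_iff w f

@[simp] theorem wdeg_zero {w : Fin n → Γ} : wdeg w (0 : MvPolynomial (Fin n) k) = ⊥ :=
  weightedTotalDegree'_zero w

theorem wdeg_add_le (w : Fin n → Γ) (f g : MvPolynomial (Fin n) k) :
    wdeg w (f + g) ≤ max (wdeg w f) (wdeg w g) := by
  refine wdeg_le_iff.2 fun s hs => ?_
  rw [coeff_add] at hs
  by_cases hf : coeff s f = 0
  · exact le_max_of_le_right (le_wdeg (by simpa [hf] using hs))
  · exact le_max_of_le_left (le_wdeg hf)

@[simp] theorem wdeg_neg (w : Fin n → Γ) (f : MvPolynomial (Fin n) k) :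
    wdeg w (-f) = wdeg w f := by
  simp [wdeg, weightedTotalDegree']

theorem wdeg_sub_le (w : Fin n → Γ) (f g : MvPolynomial (Fin n) k) :
    wdeg w (f - g) ≤ max (wdeg w f) (wdeg w g) := by
  simpa [sub_eq_add_neg] using wdeg_add_le w f (-g)

theorem wdeg_sum_le {ι : Type*} (w : Fin n → Γ) (s : Finset ι) (f : ι → MvPolynomial (Fin n) k)
    {a : WithBot Γ} (h : ∀ i ∈ s, wdeg w (f i) ≤ a) : wdeg w (∑ i ∈ s, f i) ≤ a := by
  classical
  induction s using Finset.induction_on with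
  | empty => simp
  | insert i s hi ih =>
    rw [Finset.sum_insert hi]
    exact (wdeg_add_le w _ _).trans (max_le (h i (Finset.mem_insert_self i s))
      (ih fun j hj => h j (Finset.mem_insert_of_mem hj)))

theorem wdeg_add_eq_of_lt {w : Fin n → Γ} {f g : MvPolynomial (Fin n) k}
    (h : wdeg w g < wdeg w f) : wdeg w (f + g) = wdeg w f := by
  refine le_antisymm ((wdeg_add_le w f g).trans (max_le le_rfl h.le)) ?_
  have := wdeg_sub_le w (f + g) g
  rw [add_sub_cancel_right] at this
  rcases le_max_iff.1 this with h' | h'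
  · exact h'
  · exact absurd h (not_lt.2 h')

theorem weightedHomogeneousComponent_eq_zero_of_wdeg_lt {w : Fin n → Γ}
    {f : MvPolynomial (Fin n) k} {a : Γ} (h : wdeg w f < a) :
    weightedHomogeneousComponent w a f = 0 := by
  ext s
  classical
  rw [coeff_weightedHomogeneousComponent, coeff_zero]
  split_ifs with hs
  · by_contra h0
    have := (le_wdeg (w := w) h0).trans_lt h
    rw [hs] at this
    exact lt_irrefl _ this
  · rfl

theorem wdeg_lt_of_weightedHomogeneousComponent_eq_zero {w : Fin n → Γ}
    {f : MvPolynomial (Fin n) k} {a : Γ} (h : wdeg w f ≤ a)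
    (h0 : weightedHomogeneousComponent w a f = 0) : wdeg w f < a := by
  rw [wdeg, weightedTotalDegree', Finset.sup_lt_iff (WithBot.bot_lt_coe a)]
  intro s hs
  rw [mem_support_iff] at hs
  refine lt_of_le_of_ne ((le_wdeg hs).trans h) fun hsa => hs ?_
  classical
  have := congrArg (coeff s) h0
  rwa [coeff_weightedHomogeneousComponent, if_pos (WithBot.coe_injective hsa), coeff_zero] at this

theorem wdeg_eq_of_weightedHomogeneousComponent_ne_zero {w : Fin n → Γ}
    {f : MvPolynomial (Fin n) k} {a : Γ} (h : wdeg w f ≤ a)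
    (h0 : weightedHomogeneousComponent w a f ≠ 0) : wdeg w f = a :=
  h.eq_of_not_lt fun h' => h0 (weightedHomogeneousComponent_eq_zero_of_wdeg_lt h')

theorem lead_eq {w : Fin n → Γ} {f : MvPolynomial (Fin n) k} {a : Γ} (h : wdeg w f = a) :
    lead w f = weightedHomogeneousComponent w a f := by
  simp [lead, h]

theorem lead_ne_zero {w : Fin n → Γ} {f : MvPolynomial (Fin n) k} (h : f ≠ 0) :
    lead w f ≠ 0 := by
  obtain ⟨a, ha⟩ := WithBot.ne_bot_iff_exists.1 (mt (wdeg_eq_bot (w := w)).1 h)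
  rw [lead_eq ha.symm]
  intro h0
  exact (wdeg_lt_of_weightedHomogeneousComponent_eq_zero ha.symm.le h0).ne ha.symm

theorem lead_isWeightedHomogeneous {w : Fin n → Γ} {f : MvPolynomial (Fin n) k} {a : Γ}
    (h : wdeg w f = a) : IsWeightedHomogeneous w (lead w f) a := by
  rw [lead_eq h]
  exact weightedHomogeneousComponent_isWeightedHomogeneous a f

theorem lead_add_of_lt {w : Fin n → Γ} {f g : MvPolynomial (Fin n) k}
    (h : wdeg w g < wdeg w f) : lead w (f + g) = lead w f := by
  obtain ⟨a, ha⟩ := WithBot.ne_bot_iff_exists.1 (ne_bot_of_gt h)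
  have hg : weightedHomogeneousComponent w a g = 0 :=
    weightedHomogeneousComponent_eq_zero_of_wdeg_lt (h.trans_eq ha.symm)
  rw [lead_eq ((wdeg_add_eq_of_lt h).trans ha.symm), lead_eq ha.symm, map_add, hg, add_zero]

theorem wdeg_le_of_isWeightedHomogeneous {w : Fin n → Γ} {f : MvPolynomial (Fin n) k} {a : Γ}
    (h : IsWeightedHomogeneous w f a) : wdeg w f ≤ a :=
  wdeg_le_iff.2 fun _ hs => (congrArg WithBot.some (h hs)).le

theorem wdeg_C {w : Fin n → Γ} {c : k} (hc : c ≠ 0) :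
    wdeg w (C c : MvPolynomial (Fin n) k) = (0 : Γ) :=
  wdeg_eq_of_weightedHomogeneousComponent_ne_zero
    (wdeg_le_of_isWeightedHomogeneous (isWeightedHomogeneous_C w c)) (by
      rw [(isWeightedHomogeneous_C w c).weightedHomogeneousComponent_same]
      simpa using hc)

theorem wdeg_C_le (w : Fin n → Γ) (c : k) :
    wdeg w (C c : MvPolynomial (Fin n) k) ≤ (0 : Γ) :=
  wdeg_le_of_isWeightedHomogeneous (isWeightedHomogeneous_C w c)

theorem lead_C (w : Fin n → Γ) (c : k) :
    lead w (C c : MvPolynomial (Fin n) k) = C c := by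
  by_cases hc : c = 0
  · simp [hc, lead]
  · rw [lead_eq (wdeg_C hc), (isWeightedHomogeneous_C w c).weightedHomogeneousComponent_same]

variable [IsOrderedAddMonoid Γ]

theorem weightedHomogeneousComponent_mul_of_wdeg_le {w : Fin n → Γ}
    {f g : MvPolynomial (Fin n) k} {a b : Γ} (hf : wdeg w f ≤ a) (hg : wdeg w g ≤ b) :
    weightedHomogeneousComponent w (a + b) (f * g) =
      weightedHomogeneousComponent w a f * weightedHomogeneousComponent w b g := by
  classical
  ext s
  by_cases hs : Finsupp.weight w s = a + b
  · rw [coeff_weightedHomogeneousComponent, if_pos hs, coeff_mul, coeff_mul]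
    refine Finset.sum_congr rfl fun x hx => ?_
    rw [Finset.HasAntidiagonal.mem_antidiagonal] at hx
    rw [coeff_weightedHomogeneousComponent, coeff_weightedHomogeneousComponent]
    have hsum : Finsupp.weight w x.1 + Finsupp.weight w x.2 = a + b := by
      rw [← hs, ← hx, map_add]
    by_cases hx1 : coeff x.1 f = 0
    · simp [hx1]
    by_cases hx2 : coeff x.2 g = 0
    · simp [hx2]
    have h1 : Finsupp.weight w x.1 ≤ a := WithBot.coe_le_coe.1 ((le_wdeg hx1).trans hf)
    have h2 : Finsupp.weight w x.2 ≤ b := WithBot.coe_le_coe.1 ((le_wdeg hx2).trans hg)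
    have h1' : Finsupp.weight w x.1 = a := by
      refine h1.eq_of_not_lt fun h => ?_
      exact (add_lt_add_of_lt_of_le h h2).ne hsum
    rw [if_pos h1', if_pos (by rw [h1'] at hsum; exact add_left_cancel hsum)]
  · rw [(weightedHomogeneousComponent_isWeightedHomogeneous _ _).coeff_eq_zero s hs]
    exact (((weightedHomogeneousComponent_isWeightedHomogeneous a f).mul
      (weightedHomogeneousComponent_isWeightedHomogeneous b g)).coeff_eq_zero s hs).symm

theorem wdeg_mul_le_of_le {w : Fin n → Γ} {f g : MvPolynomial (Fin n) k} {a b : Γ}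
    (hf : wdeg w f ≤ a) (hg : wdeg w g ≤ b) : wdeg w (f * g) ≤ ((a + b : Γ) : WithBot Γ) := by
  classical
  refine wdeg_le_iff.2 fun s hs => ?_
  rw [coeff_mul] at hs
  obtain ⟨x, hx, hx0⟩ := Finset.exists_ne_zero_of_sum_ne_zero hs
  rw [Finset.HasAntidiagonal.mem_antidiagonal] at hx
  rw [← hx, map_add, WithBot.coe_le_coe]
  exact add_le_add (WithBot.coe_le_coe.1 ((le_wdeg (left_ne_zero_of_mul hx0)).trans hf))
    (WithBot.coe_le_coe.1 ((le_wdeg (right_ne_zero_of_mul hx0)).trans hg))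

theorem wdeg_mul_and_lead_mul {w : Fin n → Γ} {f g : MvPolynomial (Fin n) k} {a b : Γ}
    (hf : wdeg w f = a) (hg : wdeg w g = b) :
    wdeg w (f * g) = ((a + b : Γ) : WithBot Γ) ∧ lead w (f * g) = lead w f * lead w g := by
  have hf0 : f ≠ 0 := fun h => by simp [h] at hf
  have hg0 : g ≠ 0 := fun h => by simp [h] at hg
  have h := weightedHomogeneousComponent_mul_of_wdeg_le hf.le hg.le
  rw [← lead_eq hf, ← lead_eq hg] at h
  have hd : wdeg w (f * g) = ((a + b : Γ) : WithBot Γ) :=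
    wdeg_eq_of_weightedHomogeneousComponent_ne_zero (wdeg_mul_le_of_le hf.le hg.le)
      (h ▸ mul_ne_zero (lead_ne_zero hf0) (lead_ne_zero hg0))
  exact ⟨hd, (lead_eq hd).trans h⟩

theorem wdeg_mul (w : Fin n → Γ) (f g : MvPolynomial (Fin n) k) :
    wdeg w (f * g) = wdeg w f + wdeg w g := by
  rcases hf : wdeg w f with _ | a
  · rw [wdeg_eq_bot.1 hf]; simp; rfl
  rcases hg : wdeg w g with _ | b
  · rw [wdeg_eq_bot.1 hg]; simp; rfl
  exact (wdeg_mul_and_lead_mul hf hg).1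

theorem lead_mul (w : Fin n → Γ) (f g : MvPolynomial (Fin n) k) :
    lead w (f * g) = lead w f * lead w g := by
  rcases hf : wdeg w f with _ | a
  · rw [wdeg_eq_bot.1 hf]; simp [lead]
  rcases hg : wdeg w g with _ | b
  · rw [wdeg_eq_bot.1 hg]; simp [lead]
  exact (wdeg_mul_and_lead_mul hf hg).2

theorem wdeg_pow {w : Fin n → Γ} {f : MvPolynomial (Fin n) k} {a : Γ} (hf : wdeg w f = a)
    (i : ℕ) : wdeg w (f ^ i) = ((i • a : Γ) : WithBot Γ) := by
  induction i with
  | zero => simpa using wdeg_C (w := w) (one_ne_zero (α := k))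
  | succ i ih => rw [pow_succ, wdeg_mul, ih, hf, succ_nsmul, WithBot.coe_add]

theorem lead_pow (w : Fin n → Γ) (f : MvPolynomial (Fin n) k) (i : ℕ) :
    lead w (f ^ i) = lead w f ^ i := by
  induction i with
  | zero => simpa using lead_C w (1 : k)
  | succ i ih => rw [pow_succ, lead_mul, ih, pow_succ]

theorem weightedHomogeneousComponent_pow_of_wdeg_eq {w : Fin n → Γ}
    {f : MvPolynomial (Fin n) k} {a : Γ} (hf : wdeg w f = a) (i : ℕ) :
    weightedHomogeneousComponent w (i • a) (f ^ i) = lead w f ^ i := by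
  rw [← lead_eq (wdeg_pow hf i), lead_pow]

/-- The degree and the leading form of a univariate polynomial expression `u(f)`. -/
theorem wdeg_aeval_and_lead_aeval {w : Fin n → Γ} {f : MvPolynomial (Fin n) k} {a : Γ}
    (hf : wdeg w f = a) (ha : 0 < a) {u : Polynomial k} (hu : u ≠ 0) :
    wdeg w (Polynomial.aeval f u) = ((u.natDegree • a : Γ) : WithBot Γ) ∧
      lead w (Polynomial.aeval f u) = C u.leadingCoeff * lead w f ^ u.natDegree := by
  have htop : wdeg w (C u.leadingCoeff * f ^ u.natDegree) = ((u.natDegree • a : Γ) : WithBot Γ) := by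
    rw [wdeg_mul, wdeg_pow hf, wdeg_C (by simpa using hu), ← WithBot.coe_add, zero_add]
  have hlt : wdeg w (Polynomial.aeval f u.eraseLead) <
      wdeg w (C u.leadingCoeff * f ^ u.natDegree) := by
    rw [htop, Polynomial.aeval_eq_sum_range]
    rcases Polynomial.eraseLead_natDegree_lt_or_eraseLead_eq_zero u with h | h
    · refine lt_of_le_of_lt (b := ((u.eraseLead.natDegree • a : Γ) : WithBot Γ))
        (wdeg_sum_le w _ _ fun i hi => ?_) (WithBot.coe_lt_coe.2 (nsmul_lt_nsmul_left ha h))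
      rw [smul_eq_C_mul]
      refine (wdeg_mul_le_of_le (wdeg_C_le w _) (wdeg_pow hf i).le).trans ?_
      rw [WithBot.coe_le_coe, zero_add]
      exact nsmul_le_nsmul_left ha.le (Nat.lt_succ_iff.1 (Finset.mem_range.1 hi))
    · simpa [h] using WithBot.bot_lt_coe (u.natDegree • a)
  have hsplit : Polynomial.aeval f u =
      C u.leadingCoeff * f ^ u.natDegree + Polynomial.aeval f u.eraseLead := by
    conv_lhs => rw [← Polynomial.eraseLead_add_monomial_natDegree_leadingCoeff u]
    rw [map_add, Polynomial.aeval_monomial, add_comm]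
    rfl
  rw [hsplit]
  exact ⟨(wdeg_add_eq_of_lt hlt).trans htop, by
    rw [lead_add_of_lt hlt, lead_mul, lead_C, lead_pow]⟩

theorem wdeg_ne_bot_and_pos {w : Fin n → Γ} (hw : ∀ i, 0 < w i) {f : MvPolynomial (Fin n) k}
    (hf : ∀ c, f ≠ C c) : ∃ a : Γ, wdeg w f = a ∧ 0 < a := by
  have : ∃ s, coeff s f ≠ 0 ∧ s ≠ 0 := by
    by_contra! h
    refine hf (coeff 0 f) (MvPolynomial.ext _ _ fun s => ?_)
    classical
    rw [coeff_C]
    split_ifs with hs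
    · rw [hs]
    · by_contra h0
      exact hs (h s h0).symm
  obtain ⟨s, hs, hs0⟩ := this
  obtain ⟨i, hi⟩ := Finsupp.ne_iff.1 hs0
  have hpos : 0 < Finsupp.weight w s := by
    rw [Finsupp.weight_apply, Finsupp.sum]
    refine Finset.sum_pos (fun j hj => nsmul_pos (hw j) (Finsupp.mem_support_iff.1 hj)) ⟨i, ?_⟩
    simpa using hi
  obtain ⟨a, ha⟩ := WithBot.ne_bot_iff_exists.1
    (fun h : wdeg w f = ⊥ => hs (by rw [wdeg_eq_bot.1 h, coeff_zero]))
  refine ⟨a, ha.symm, hpos.trans_le ?_⟩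
  have := le_wdeg (w := w) hs
  rwa [← ha, WithBot.coe_le_coe] at this

/-- A homogeneous element of `k[f]`, `f` homogeneous of positive degree, is a monomial in `f`. -/
theorem eq_C_mul_pow_of_mem_adjoin {w : Fin n → Γ} {f h : MvPolynomial (Fin n) k} {a b : Γ}
    (hf : IsWeightedHomogeneous w f a) (ha : 0 < a) (hh : IsWeightedHomogeneous w h b)
    (h0 : h ≠ 0) (hmem : h ∈ Algebra.adjoin k {f}) :
    ∃ (c : k) (j : ℕ), h = C c * f ^ j ∧ j • a = b := by
  rw [Algebra.adjoin_singleton_eq_range_aeval] at hmem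
  obtain ⟨u, hu⟩ := hmem
  replace hu : Polynomial.aeval f u = h := hu
  subst hu
  have hpow : ∀ j : ℕ, IsWeightedHomogeneous w (u.coeff j • f ^ j) (j • a) := fun j => by
    rw [smul_eq_C_mul]
    exact (hf.pow j).C_mul _
  have key : Polynomial.aeval f u = ∑ i ∈ Finset.range (u.natDegree + 1),
      if i • a = b then u.coeff i • f ^ i else 0 := by
    rw [← hh.weightedHomogeneousComponent_same, Polynomial.aeval_eq_sum_range,
      map_sum]
    refine Finset.sum_congr rfl fun i _ => ?_
    split_ifs with hi
    · rw [← hi, (hpow i).weightedHomogeneousComponent_same]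
    · exact (hpow i).weightedHomogeneousComponent_ne b (Ne.symm hi)
  rw [key] at h0
  obtain ⟨j, hj, hj0⟩ := Finset.exists_ne_zero_of_sum_ne_zero h0
  have hjb : j • a = b := by
    by_contra h
    exact hj0 (if_neg h)
  refine ⟨u.coeff j, j, ?_, hjb⟩
  rw [key, Finset.sum_eq_single_of_mem j hj, if_pos hjb, smul_eq_C_mul]
  intro i _ hij
  refine if_neg fun hi => hij ?_
  rcases lt_trichotomy i j with h | h | h
  · exact absurd (hi.trans hjb.symm) (nsmul_lt_nsmul_left ha h).ne
  · exact h
  · exact absurd (hi.trans hjb.symm) (nsmul_lt_nsmul_left ha h).ne'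

end Degree

/-! ### Degrees of 2-forms and the chain rule for df ∧ dΦ(f, g). -/

section Forms

variable [LinearOrder Γ]

/-- The two-forms on `k[x]`. -/
abbrev TwoForm (k : Type*) [Field k] (n : ℕ) : Type _ :=
  ⋀[MvPolynomial (Fin n) k]^2 (KaehlerDifferential k (MvPolynomial (Fin n) k))

theorem formBasis_repr_dWedge (f g : MvPolynomial (Fin n) k) (s : Set.powersetCard (Fin n) 2) :
    ∃ i j, (s : Finset (Fin n)) = {i, j} ∧ i ≠ j ∧
      (formBasis k n 2).repr (dWedge f g) s =
        pderiv i f * pderiv j g - pderiv j f * pderiv i g := by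
  refine ⟨Set.powersetCard.ofFinEmbEquiv.symm s 0, Set.powersetCard.ofFinEmbEquiv.symm s 1,
    ?_, ?_, ?_⟩
  · ext i
    have := Set.powersetCard.mem_range_ofFinEmbEquiv_symm_iff_mem s i
    rw [Set.powersetCard.mem_coe_iff, ← this]
    simp [Fin.exists_fin_two, eq_comm]
  · exact fun h => absurd ((Set.powersetCard.ofFinEmbEquiv.symm s).injective h) (by simp)
  · rw [formBasis, exteriorPower.basis_repr_apply, dWedge, exteriorPower.ιMultiDual_apply_ιMulti,
      Matrix.det_fin_two]
    simp [KaehlerDifferential.mvPolynomialBasis_repr_apply]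

theorem formDeg_le_iff {w : Fin n → Γ} {ω : TwoForm k n} {a : WithBot Γ} :
    formDeg w ω ≤ a ↔ ∀ s : Set.powersetCard (Fin n) 2,
      wdeg w ((formBasis k n 2).repr ω s * ∏ i ∈ (s : Finset (Fin n)), X i) ≤ a := by
  simp [formDeg, Finset.sup_le_iff]

theorem formDeg_sub_le (w : Fin n → Γ) (ω η : TwoForm k n) :
    formDeg w (ω - η) ≤ max (formDeg w ω) (formDeg w η) := by
  refine formDeg_le_iff.2 fun s => ?_
  rw [map_sub, Finsupp.sub_apply, sub_mul]
  exact (wdeg_sub_le w _ _).trans (max_le_max (formDeg_le_iff.1 le_rfl s)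
    (formDeg_le_iff.1 le_rfl s))

@[simp] theorem formDeg_neg (w : Fin n → Γ) (ω : TwoForm k n) :
    formDeg w (-ω) = formDeg w ω := by
  simp [formDeg]

theorem wdeg_pderiv_mul_X_le (w : Fin n → Γ) (i : Fin n) (f : MvPolynomial (Fin n) k) :
    wdeg w (pderiv i f * X i) ≤ wdeg w f := by
  conv_lhs => rw [f.as_sum]
  rw [map_sum, Finset.sum_mul]
  refine wdeg_sum_le w _ _ fun s hs => ?_
  rw [pderiv_monomial]
  by_cases hsi : s i = 0
  · simp [hsi]
  · rw [X, monomial_mul, mul_one, tsub_add_cancel_of_le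
      (Finsupp.single_le_iff.2 (Nat.one_le_iff_ne_zero.2 hsi))]
    exact (wdeg_le_of_isWeightedHomogeneous (isWeightedHomogeneous_monomial w s _ rfl)).trans
      (le_wdeg (mem_support_iff.1 hs))

variable [IsOrderedAddMonoid Γ]

theorem formDeg_smul (w : Fin n → Γ) (h : MvPolynomial (Fin n) k) (ω : TwoForm k n) :
    formDeg w (h • ω) = wdeg w h + formDeg w ω := by
  have key : ∀ s : Set.powersetCard (Fin n) 2,
      wdeg w ((formBasis k n 2).repr (h • ω) s * ∏ i ∈ (s : Finset (Fin n)), X i) =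
      wdeg w h + wdeg w ((formBasis k n 2).repr ω s * ∏ i ∈ (s : Finset (Fin n)), X i) := by
    intro s
    rw [map_smul, Finsupp.smul_apply, smul_eq_mul, mul_assoc, wdeg_mul]
  refine le_antisymm (formDeg_le_iff.2 fun s => ?_) ?_
  · rw [key]
    gcongr
    exact formDeg_le_iff.1 le_rfl s
  · rcases hb : formDeg w ω with _ | b
    · change wdeg w h + ⊥ ≤ _
      simp
    · obtain ⟨s, -, hs⟩ := (Finset.le_sup_iff (WithBot.bot_lt_coe b)).1 (hb.symm.le)
      calc wdeg w h + (b : WithBot Γ) ≤ _ := by gcongr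
        _ = _ := (key s).symm
        _ ≤ _ := formDeg_le_iff.1 le_rfl s

theorem formDeg_dWedge_le (w : Fin n → Γ) (f g : MvPolynomial (Fin n) k) :
    formDeg w (dWedge f g) ≤ wdeg w f + wdeg w g := by
  refine formDeg_le_iff.2 fun s => ?_
  obtain ⟨i, j, hs, hij, h⟩ := formBasis_repr_dWedge f g s
  have : (formBasis k n 2).repr (dWedge f g) s * ∏ i ∈ (s : Finset (Fin n)), X i =
      (pderiv i f * X i) * (pderiv j g * X j) - (pderiv j f * X j) * (pderiv i g * X i) := by
    rw [h, hs, Finset.prod_pair hij]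
    ring
  rw [this]
  refine (wdeg_sub_le w _ _).trans (max_le ?_ ?_) <;> rw [wdeg_mul] <;> gcongr <;>
    exact wdeg_pderiv_mul_X_le w _ _

/-- Each coefficient enters the degree multiplied by two variables, so a nonzero term vanishes at
the origin and cannot be constant. -/
theorem formDeg_pos {w : Fin n → Γ} (hw : ∀ i, 0 < w i) {ω : TwoForm k n} {b : Γ}
    (hb : formDeg w ω = b) : 0 < b := by
  obtain ⟨s, -, hs⟩ := (Finset.le_sup_iff (WithBot.bot_lt_coe b)).1 hb.symm.le
  obtain ⟨i, j, hs', hij, -⟩ := formBasis_repr_dWedge (0 : MvPolynomial (Fin n) k) 0 s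
  refine WithBot.coe_lt_coe.1 (lt_of_lt_of_eq ?_ hb)
  have hX : ∃ a : Γ, wdeg w ((formBasis k n 2).repr ω s *
      ∏ i ∈ (s : Finset (Fin n)), (X i : MvPolynomial (Fin n) k)) = a ∧ 0 < a := by
    refine wdeg_ne_bot_and_pos hw fun c hc => ?_
    have h0 : (formBasis k n 2).repr ω s * ∏ i ∈ (s : Finset (Fin n)),
        (X i : MvPolynomial (Fin n) k) ≠ 0 := by
      intro h
      rw [h, wdeg_zero] at hs
      exact absurd hs (by simp)
    rw [hs', Finset.prod_pair hij] at hc h0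
    have hc' := congrArg (eval (0 : Fin n → k)) hc
    simp only [map_mul, eval_X, Pi.zero_apply, mul_zero, eval_C] at hc'
    exact h0 (by rw [hc, ← hc', C_0])
  obtain ⟨a, ha, ha0⟩ := hX
  calc (0 : WithBot Γ) < a := WithBot.coe_lt_coe.2 ha0
    _ = _ := ha.symm
    _ ≤ _ := formDeg_le_iff.1 le_rfl s

/-- The derivation `g ↦ df ∧ dg`. -/
def dWedgeDerivation (f : MvPolynomial (Fin n) k) :
    Derivation k (MvPolynomial (Fin n) k) (TwoForm k n) :=
  LinearMap.compDer ((exteriorPower.ιMulti (MvPolynomial (Fin n) k) 2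
    (M := KaehlerDifferential k (MvPolynomial (Fin n) k))).toMultilinearMap.toLinearMap
      ![KaehlerDifferential.D k (MvPolynomial (Fin n) k) f, 0] 1)
    (KaehlerDifferential.D k (MvPolynomial (Fin n) k))

end Forms

section Forms

theorem dWedgeDerivation_apply (f g : MvPolynomial (Fin n) k) :
    dWedgeDerivation f g = dWedge f g := by
  have : Function.update ![KaehlerDifferential.D k (MvPolynomial (Fin n) k) f, 0] 1
      (KaehlerDifferential.D k (MvPolynomial (Fin n) k) g) =
      ![KaehlerDifferential.D k (MvPolynomial (Fin n) k) f,
        KaehlerDifferential.D k (MvPolynomial (Fin n) k) g] := by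
    ext i
    fin_cases i <;> simp
  exact congrArg (exteriorPower.ιMulti (MvPolynomial (Fin n) k) 2) this

@[simp] theorem dWedge_self (f : MvPolynomial (Fin n) k) : dWedge f f = 0 :=
  AlternatingMap.map_eq_zero_of_eq _ _ (i := 0) (j := 1) (by simp) (by simp)

theorem dWedge_swap (f g : MvPolynomial (Fin n) k) : dWedge g f = -dWedge f g := by
  have := AlternatingMap.map_swap (exteriorPower.ιMulti (MvPolynomial (Fin n) k) 2)
    ![KaehlerDifferential.D k (MvPolynomial (Fin n) k) f,
      KaehlerDifferential.D k (MvPolynomial (Fin n) k) g] (i := 0) (j := 1) (by simp)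
  rw [dWedge, dWedge, ← this]
  congr 1
  ext i
  fin_cases i <;> simp

theorem dWedge_add_right (f g h : MvPolynomial (Fin n) k) :
    dWedge f (g + h) = dWedge f g + dWedge f h := by
  simp only [← dWedgeDerivation_apply, map_add]

theorem dWedge_mul_right (f g h : MvPolynomial (Fin n) k) :
    dWedge f (g * h) = g • dWedge f h + h • dWedge f g := by
  simp only [← dWedgeDerivation_apply, Derivation.leibniz]

theorem dWedge_aeval_right (f g : MvPolynomial (Fin n) k) (u : Polynomial k) :
    dWedge f (Polynomial.aeval g u) =
      Polynomial.aeval g (Polynomial.derivative u) • dWedge f g := by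
  simp only [← dWedgeDerivation_apply, Derivation.map_aeval]

/-- The polynomial `Φ(f, g)`, for `Φ` a polynomial over `k[X]`. -/
def evalPair (f g : MvPolynomial (Fin n) k) (Φ : Polynomial (Polynomial k)) :
    MvPolynomial (Fin n) k :=
  (Φ.map (Polynomial.aeval f).toRingHom).eval g

/-- Only the derivative in the second variable survives, since df ∧ df = 0. This is what converts
degrees of forms into degrees of derivatives of Φ. -/
theorem dWedge_evalPair (f g : MvPolynomial (Fin n) k) (Φ : Polynomial (Polynomial k)) :
    dWedge f (evalPair f g Φ) = evalPair f g (Polynomial.derivative Φ) • dWedge f g := by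
  induction Φ using Polynomial.induction_on' with
  | add p q hp hq =>
    have h : ∀ p q, evalPair f g (p + q) = evalPair f g p + evalPair f g q := fun p q => by
      simp [evalPair]
    rw [h, dWedge_add_right, hp, hq, map_add, h, add_smul]
  | monomial i u =>
    have hpow : dWedge f (g ^ i) = ((i : MvPolynomial (Fin n) k) * g ^ (i - 1)) • dWedge f g := by
      rw [← dWedgeDerivation_apply, Derivation.leibniz_pow, dWedgeDerivation_apply, mul_smul,
        Nat.cast_smul_eq_nsmul]
    simp only [evalPair, Polynomial.derivative_monomial, Polynomial.map_monomial,
      Polynomial.eval_monomial]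
    change dWedge f (Polynomial.aeval f u * g ^ i) = _
    rw [dWedge_mul_right, dWedge_aeval_right, dWedge_self, smul_zero, smul_zero, add_zero, hpow,
      smul_smul]
    congr 1
    simp [mul_assoc]

theorem mem_adjoin_pair_iff {f g h : MvPolynomial (Fin n) k} :
    h ∈ Algebra.adjoin k {f, g} ↔ ∃ Φ, h = evalPair f g Φ := by
  constructor
  · intro hh
    induction hh using Algebra.adjoin_induction with
    | mem x hx =>
      rcases hx with rfl | rfl
      · exact ⟨Polynomial.C Polynomial.X, by simp [evalPair]⟩
      · exact ⟨Polynomial.X, by simp [evalPair]⟩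
    | algebraMap c => exact ⟨Polynomial.C (Polynomial.C c), by simp [evalPair]⟩
    | add x y _ _ hx hy =>
      obtain ⟨p, rfl⟩ := hx
      obtain ⟨q, rfl⟩ := hy
      exact ⟨p + q, by simp [evalPair]⟩
    | mul x y _ _ hx hy =>
      obtain ⟨p, rfl⟩ := hx
      obtain ⟨q, rfl⟩ := hy
      exact ⟨p * q, by simp [evalPair]⟩
  · rintro ⟨Φ, rfl⟩
    rw [evalPair, Polynomial.eval_eq_sum_range]
    refine Subalgebra.sum_mem _ fun i _ => Subalgebra.mul_mem _ ?_
      (Subalgebra.pow_mem _ (Algebra.subset_adjoin (by simp)) i)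
    rw [Polynomial.coeff_map]
    exact Algebra.adjoin_mono (s := {f}) (by simp) (Polynomial.aeval_mem_adjoin_singleton k f)

theorem coeff_map_aeval (f : MvPolynomial (Fin n) k) (Φ : Polynomial (Polynomial k)) (i : ℕ) :
    (Φ.map (Polynomial.aeval f).toRingHom).coeff i = Polynomial.aeval f (Φ.coeff i) := by
  rw [Polynomial.coeff_map]
  rfl

end Forms

/-! ### Multiplicity of a root versus number of terms. -/

section Fewnomial

/-- In characteristic zero the multiplicity of a nonzero root is less than the number of terms. -/
theorem lt_card_support_of_pow_dvd {R : Type*} [CommRing R] [IsDomain R] [CharZero R] {g : R}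
    (hg : g ≠ 0) (m : ℕ) (T : Polynomial R) (hT : T ≠ 0)
    (hdvd : (Polynomial.X - Polynomial.C g) ^ m ∣ T) : m < T.support.card := by
  induction m generalizing T with
  | zero => exact Finset.card_pos.2 (Polynomial.support_nonempty.2 hT)
  | succ m ih =>
    -- S = X T' - j T multiplies the coefficient of X^i by i - j. It removes exactly the lowest
    -- term, and the root loses at most one multiplicity.
    set j := T.natTrailingDegree with hj
    set S : Polynomial R := Polynomial.X * Polynomial.derivative T - Polynomial.C (j : R) * T
      with hS
    have hcoeff : ∀ i, S.coeff i = ((i : R) - j) * T.coeff i := by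
      intro i
      rw [hS, Polynomial.coeff_sub, Polynomial.coeff_C_mul]
      cases i with
      | zero => simp
      | succ i =>
        rw [Polynomial.coeff_X_mul, Polynomial.coeff_derivative]
        push_cast
        ring
    have hsupp : S.support = T.support.erase j := by
      ext i
      rw [Finset.mem_erase, Polynomial.mem_support_iff, Polynomial.mem_support_iff, hcoeff,
        mul_ne_zero_iff, sub_ne_zero, Nat.cast_inj.ne]
    have hjmem : j ∈ T.support := Polynomial.natTrailingDegree_mem_support_of_nonzero hT
    have hS0 : S ≠ 0 := by
      intro h0
      rw [h0, Polynomial.support_zero] at hsupp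
      have hT1 : T = Polynomial.monomial j (T.coeff j) := by
        ext i
        rw [Polynomial.coeff_monomial]
        split_ifs with hi
        · rw [hi]
        · by_contra hne
          have : i ∈ T.support.erase j :=
            Finset.mem_erase.2 ⟨Ne.symm hi, Polynomial.mem_support_iff.2 hne⟩
          rw [← hsupp] at this
          simp at this
      have hroot : T.eval g = 0 :=
        Polynomial.dvd_iff_isRoot.1 ((dvd_pow_self _ m.succ_ne_zero).trans hdvd)
      rw [hT1, Polynomial.eval_monomial] at hroot
      exact mul_ne_zero (Polynomial.mem_support_iff.1 hjmem) (pow_ne_zero _ hg) hroot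
    have hdvdS : (Polynomial.X - Polynomial.C g) ^ m ∣ S :=
      dvd_sub (Dvd.dvd.mul_left
        (by simpa using Polynomial.pow_sub_one_dvd_derivative_of_pow_dvd hdvd) _)
        (Dvd.dvd.mul_left ((pow_dvd_pow _ m.le_succ).trans hdvd) _)
    have := ih S hS0 hdvdS
    rw [hsupp, Finset.card_erase_of_mem hjmem] at this
    omega

end Fewnomial

/-! ### Weighted top parts of polynomials in one variable over k[x]. -/

section TopForm

/-- For weights `e` on the variable and `w` on the coefficients, the part of degree `N` of `P`. -/
def topForm (w : Fin n → Γ) (e N : Γ) (P : Polynomial (MvPolynomial (Fin n) k)) :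
    Polynomial (MvPolynomial (Fin n) k) :=
  ∑ i ∈ P.support, Polynomial.monomial i (weightedHomogeneousComponent w (N - i • e) (P.coeff i))

theorem coeff_topForm (w : Fin n → Γ) (e N : Γ) (P : Polynomial (MvPolynomial (Fin n) k)) (i : ℕ) :
    (topForm w e N P).coeff i = weightedHomogeneousComponent w (N - i • e) (P.coeff i) := by
  rw [topForm, Polynomial.finsetSum_coeff]
  simp only [Polynomial.coeff_monomial]
  rw [Finset.sum_ite_eq' P.support i]
  split_ifs with h
  · rfl
  · rw [Polynomial.notMem_support_iff.1 h, map_zero]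

theorem derivative_topForm (w : Fin n → Γ) (e N : Γ) (P : Polynomial (MvPolynomial (Fin n) k)) :
    Polynomial.derivative (topForm w e N P) = topForm w e (N - e) (Polynomial.derivative P) := by
  ext1 i
  have hC : ((i : MvPolynomial (Fin n) k) + 1) = C (i + 1 : k) := by simp
  rw [Polynomial.coeff_derivative, coeff_topForm, coeff_topForm, Polynomial.coeff_derivative, hC,
    mul_comm, mul_comm _ (C _), weightedHomogeneousComponent_C_mul, succ_nsmul', sub_sub]

theorem iterate_derivative_topForm (w : Fin n → Γ) (e N : Γ)
    (P : Polynomial (MvPolynomial (Fin n) k)) (m : ℕ) :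
    Polynomial.derivative^[m] (topForm w e N P) =
      topForm w e (N - m • e) (Polynomial.derivative^[m] P) := by
  induction m with
  | zero => simp
  | succ m ih =>
    rw [Function.iterate_succ_apply', ih, derivative_topForm, Function.iterate_succ_apply',
      succ_nsmul, sub_sub]

variable [LinearOrder Γ] [IsOrderedAddMonoid Γ]

theorem wdeg_coeff_iterate_derivative_le {w : Fin n → Γ} {e N : Γ}
    {P : Polynomial (MvPolynomial (Fin n) k)}
    (hP : ∀ i, wdeg w (P.coeff i) ≤ ((N - i • e : Γ) : WithBot Γ)) (m i : ℕ) :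
    wdeg w ((Polynomial.derivative^[m] P).coeff i) ≤ ((N - m • e - i • e : Γ) : WithBot Γ) := by
  induction m generalizing i with
  | zero => simpa using hP i
  | succ m ih =>
    have hC : ((i : MvPolynomial (Fin n) k) + 1) = C (i + 1 : k) := by simp
    have h := wdeg_mul_le_of_le (ih (i + 1)) (wdeg_C_le w (i + 1 : k))
    rw [Function.iterate_succ_apply', Polynomial.coeff_derivative, hC]
    convert h using 2
    rw [add_nsmul, add_nsmul, one_nsmul]
    abel

theorem weightedHomogeneousComponent_eval {w : Fin n → Γ} {g : MvPolynomial (Fin n) k} {e N : Γ}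
    (hg : wdeg w g = e) {P : Polynomial (MvPolynomial (Fin n) k)}
    (hP : ∀ i, wdeg w (P.coeff i) ≤ ((N - i • e : Γ) : WithBot Γ)) :
    wdeg w (P.eval g) ≤ N ∧
      weightedHomogeneousComponent w N (P.eval g) = (topForm w e N P).eval (lead w g) := by
  have hN : ∀ i : ℕ, N = (N - i • e) + i • e := fun i => (sub_add_cancel _ _).symm
  constructor
  · rw [Polynomial.eval_eq_sum_range]
    refine wdeg_sum_le w _ _ fun i _ => ?_
    rw [hN i]
    exact wdeg_mul_le_of_le (hP i) (wdeg_pow hg i).le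
  · have hdeg : (topForm w e N P).natDegree < P.natDegree + 1 := by
      rw [Nat.lt_succ_iff, Polynomial.natDegree_le_iff_coeff_eq_zero]
      intro i hi
      rw [coeff_topForm, Polynomial.coeff_eq_zero_of_natDegree_lt hi, map_zero]
    rw [Polynomial.eval_eq_sum_range, Polynomial.eval_eq_sum_range' hdeg, map_sum]
    refine Finset.sum_congr rfl fun i _ => ?_
    rw [coeff_topForm, ← weightedHomogeneousComponent_pow_of_wdeg_eq hg,
      ← weightedHomogeneousComponent_mul_of_wdeg_le (hP i) (wdeg_pow hg i).le, ← hN]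

theorem exists_topForm_ne_zero (w : Fin n → Γ) (e : Γ) {P : Polynomial (MvPolynomial (Fin n) k)}
    (h0 : P ≠ 0) : ∃ N : Γ, (∀ i, wdeg w (P.coeff i) ≤ ((N - i • e : Γ) : WithBot Γ)) ∧
      topForm w e N P ≠ 0 := by
  -- N is the largest weighted degree of a term; the default value 0 of `unbotD` is never reached on
  -- the support.
  obtain ⟨j, hj, hmax⟩ := P.support.exists_max_image
    (fun i => (wdeg w (P.coeff i)).unbotD 0 + i • e) (Polynomial.support_nonempty.2 h0)
  have hval : ∀ i ∈ P.support, wdeg w (P.coeff i) = (((wdeg w (P.coeff i)).unbotD 0 : Γ)) := by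
    intro i hi
    obtain ⟨a, ha⟩ := WithBot.ne_bot_iff_exists.1
      (mt (wdeg_eq_bot (w := w)).1 (Polynomial.mem_support_iff.1 hi))
    rw [← ha, WithBot.unbotD_coe]
  refine ⟨(wdeg w (P.coeff j)).unbotD 0 + j • e, fun i => ?_, fun h => ?_⟩
  · by_cases hi : i ∈ P.support
    · rw [hval i hi, WithBot.coe_le_coe, le_sub_iff_add_le]
      exact hmax i hi
    · rw [Polynomial.notMem_support_iff.1 hi, wdeg_zero]
      exact bot_le
  · have := congrArg (fun T => Polynomial.coeff T j) h
    simp only [coeff_topForm, add_sub_cancel_right, Polynomial.coeff_zero] at this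
    rw [← lead_eq (hval j hj)] at this
    exact lead_ne_zero (Polynomial.mem_support_iff.1 hj) this

end TopForm

/-! ### Cancellation of the top part: commensurable degrees. -/

section Cancellation

variable [LinearOrder Γ] {w : Fin n → Γ} {f g : MvPolynomial (Fin n) k} {d e N : Γ}
  {Φ : Polynomial (Polynomial k)}

/-- The leading part of `Φ(f, Y)` for the weights `deg f` and `e`. -/
abbrev topPair (w : Fin n → Γ) (f : MvPolynomial (Fin n) k) (e N : Γ)
    (Φ : Polynomial (Polynomial k)) : Polynomial (MvPolynomial (Fin n) k) :=
  topForm w e N (Φ.map (Polynomial.aeval f).toRingHom)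

/-- A single monomial has no nonzero root. -/
theorem one_lt_card_support_topPair [CharZero k] (hg : g ≠ 0) (hT : topPair w f e N Φ ≠ 0)
    (hroot : (topPair w f e N Φ).eval (lead w g) = 0) :
    1 < (topPair w f e N Φ).support.card :=
  lt_card_support_of_pow_dvd (lead_ne_zero (w := w) hg) 1 _ hT
    (by rw [pow_one]; exact Polynomial.dvd_iff_isRoot.2 hroot)

variable [IsOrderedAddMonoid Γ]

theorem coeff_topPair (hf : wdeg w f = d) (hd : 0 < d)
    (hN : ∀ i, wdeg w (Polynomial.aeval f (Φ.coeff i)) ≤ ((N - i • e : Γ) : WithBot Γ)) {i : ℕ}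
    (hi : (topPair w f e N Φ).coeff i ≠ 0) :
    Φ.coeff i ≠ 0 ∧ (Φ.coeff i).natDegree • d + i • e = N ∧
    (topPair w f e N Φ).coeff i =
      C (Φ.coeff i).leadingCoeff * lead w f ^ (Φ.coeff i).natDegree := by
  rw [coeff_topForm, coeff_map_aeval] at hi ⊢
  have h0 : Φ.coeff i ≠ 0 := fun h => hi (by rw [h, map_zero, map_zero])
  obtain ⟨hdeg, hlead⟩ := wdeg_aeval_and_lead_aeval hf hd h0
  have h := wdeg_eq_of_weightedHomogeneousComponent_ne_zero (hN i) hi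
  refine ⟨h0, ?_, (lead_eq h).symm.trans hlead⟩
  rw [hdeg, WithBot.coe_inj] at h
  rw [h, sub_add_cancel]

/-- This is the case without cancellation: the expected degree is attained and the leading form is
the top part evaluated at `lead w g`. -/
theorem wdeg_evalPair_of_eval_topPair_ne_zero (hg : wdeg w g = e)
    (hN : ∀ i, wdeg w (Polynomial.aeval f (Φ.coeff i)) ≤ ((N - i • e : Γ) : WithBot Γ))
    (hT : (topPair w f e N Φ).eval (lead w g) ≠ 0) :
    wdeg w (evalPair f g Φ) = N ∧
      lead w (evalPair f g Φ) = (topPair w f e N Φ).eval (lead w g) := by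
  obtain ⟨h1, h2⟩ := weightedHomogeneousComponent_eval (P := Φ.map (Polynomial.aeval f).toRingHom)
    hg (fun i => by rw [coeff_map_aeval]; exact hN i)
  rw [← h2] at hT
  have h3 := wdeg_eq_of_weightedHomogeneousComponent_ne_zero h1 hT
  exact ⟨h3, (lead_eq h3).trans h2⟩

theorem eval_topPair_mem_adjoin (hf : wdeg w f = d) (hd : 0 < d)
    (hN : ∀ i, wdeg w (Polynomial.aeval f (Φ.coeff i)) ≤ ((N - i • e : Γ) : WithBot Γ)) :
    (topPair w f e N Φ).eval (lead w g) ∈ Algebra.adjoin k {lead w f, lead w g} := by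
  rw [Polynomial.eval_eq_sum_range]
  refine Subalgebra.sum_mem _ fun i _ => Subalgebra.mul_mem _ ?_
    (Subalgebra.pow_mem _ (Algebra.subset_adjoin (by simp)) i)
  by_cases hi : (topPair w f e N Φ).coeff i = 0
  · rw [hi]
    exact Subalgebra.zero_mem _
  · rw [(coeff_topPair hf hd hN hi).2.2]
    exact Subalgebra.mul_mem _ (Subalgebra.algebraMap_mem _ _)
      (Subalgebra.pow_mem _ (Algebra.subset_adjoin (by simp)) _)

/-- The exponents occurring in the leading part lie on an arithmetic progression. -/
theorem exists_progression_topPair (hf : wdeg w f = d) (hd : 0 < d)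
    (hN : ∀ i, wdeg w (Polynomial.aeval f (Φ.coeff i)) ≤ ((N - i • e : Γ) : WithBot Γ))
    (hT : topPair w f e N Φ ≠ 0) {p q : ℕ} (hp : 0 < p) (hpq : p.Coprime q) (h : q • d = p • e) :
    ∃ i₀ ν₀ : ℕ, i₀ ∈ (topPair w f e N Φ).support ∧ ∀ j ∈ (topPair w f e N Φ).support,
      ∃ t, j = i₀ + p * t ∧ (Φ.coeff j).natDegree + q * t = ν₀ := by
  set T := topPair w f e N Φ
  have hi₀ : T.natTrailingDegree ∈ T.support :=
    Polynomial.natTrailingDegree_mem_support_of_nonzero hT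
  refine ⟨T.natTrailingDegree, (Φ.coeff T.natTrailingDegree).natDegree, hi₀, fun j hj => ?_⟩
  have h1 := (coeff_topPair hf hd hN (Polynomial.mem_support_iff.1 hi₀)).2.1
  have h2 := (coeff_topPair hf hd hN (Polynomial.mem_support_iff.1 hj)).2.1
  obtain ⟨x, hx⟩ := Nat.exists_eq_add_of_le
    (Polynomial.natTrailingDegree_le_of_mem_supp _ hj)
  set i₀ := T.natTrailingDegree
  set ν := (Φ.coeff j).natDegree
  set ν₀ := (Φ.coeff i₀).natDegree
  rw [← h1, hx, add_nsmul] at h2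
  have h3 : ν • d + x • e = ν₀ • d := by
    refine add_right_cancel (b := i₀ • e) ?_
    rw [← h2]
    abel
  have h4 : p * ν + x * q = p * ν₀ := by
    have h5 : (p * ν + x * q) • d = (p * ν₀) • d := by
      rw [add_nsmul, mul_nsmul', mul_nsmul' _ x q, mul_nsmul' _ p ν₀, h, ← h3, nsmul_add,
        ← mul_nsmul', ← mul_nsmul' _ x p, ← mul_nsmul' _ p x, mul_comm x p]
    exact (nsmul_left_strictMono hd).injective h5
  have h6 : p ∣ x := by
    refine hpq.dvd_of_dvd_mul_right ((Nat.dvd_add_right (dvd_mul_right p ν)).1 ?_)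
    rw [h4]
    exact dvd_mul_right p ν₀
  obtain ⟨t, rfl⟩ := h6
  refine ⟨t, hx, Nat.eq_of_mul_eq_mul_left hp ?_⟩
  rw [← h4]
  ring

theorem exists_coprime_of_cancellation [CharZero k] (hf : wdeg w f = d) (hd : 0 < d)
    (hg : wdeg w g = e) (he : 0 < e)
    (hN : ∀ i, wdeg w (Polynomial.aeval f (Φ.coeff i)) ≤ ((N - i • e : Γ) : WithBot Γ))
    (hT : topPair w f e N Φ ≠ 0) (hroot : (topPair w f e N Φ).eval (lead w g) = 0) :
    ∃ p q : ℕ, 0 < p ∧ 0 < q ∧ p.Coprime q ∧ q • d = p • e := by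
  have hg0 : g ≠ 0 := fun h => by simp [h] at hg
  obtain ⟨i, hi, j, hj, hij⟩ := Finset.one_lt_card.1 (one_lt_card_support_topPair hg0 hT hroot)
  wlog hlt : i < j generalizing i j
  · exact this j hj i hi hij.symm (lt_of_le_of_ne (not_lt.1 hlt) hij.symm)
  have h1 := (coeff_topPair hf hd hN (Polynomial.mem_support_iff.1 hi)).2.1
  have h2 := (coeff_topPair hf hd hN (Polynomial.mem_support_iff.1 hj)).2.1
  -- Two terms of the same total degree N trade a higher power of g for a lower power of f, which
  -- gives a relation between multiples of d and e.
  have hν : (Φ.coeff j).natDegree < (Φ.coeff i).natDegree := by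
    by_contra! hle
    exact (add_lt_add_of_le_of_lt (nsmul_le_nsmul_left hd.le hle)
      (nsmul_lt_nsmul_left he hlt)).ne (h1.trans h2.symm)
  obtain ⟨x, hx⟩ := Nat.exists_eq_add_of_lt hlt
  obtain ⟨y, hy⟩ := Nat.exists_eq_add_of_lt hν
  have h3 : (y + 1) • d = (x + 1) • e := by
    have h4 := h2.trans h1.symm
    rw [hy] at h4
    generalize (Φ.coeff j).natDegree = ν at h4
    rw [hx, add_assoc, add_assoc, add_nsmul _ ν, add_nsmul _ i, add_assoc, add_left_cancel_iff,
      add_comm, add_right_cancel_iff] at h4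
    exact h4.symm
  obtain ⟨p, q, hpq, hp, hq⟩ := Nat.exists_coprime (x + 1) (y + 1)
  have hgcd : 0 < (x + 1).gcd (y + 1) := Nat.gcd_pos_of_pos_left _ x.succ_pos
  refine ⟨p, q, Nat.pos_of_ne_zero ?_, Nat.pos_of_ne_zero ?_, hpq, ?_⟩
  · rintro rfl
    omega
  · rintro rfl
    omega
  · refine (nsmul_right_strictMono hgcd.ne').injective ?_
    rw [← mul_nsmul, ← mul_nsmul, ← hp, ← hq, h3]

end Cancellation

/-! ### Fractions algebraic over the ground field. -/

section Algebraic

/-- If the fraction `b / a` is algebraic over `k`, then `a ∣ b`. -/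
theorem dvd_of_aeval_div_eq_zero {a b : MvPolynomial (Fin n) k} (ha : a ≠ 0)
    {Q : Polynomial k} (hQ : Q ≠ 0)
    (h : Polynomial.aeval (algebraMap (MvPolynomial (Fin n) k)
        (FractionRing (MvPolynomial (Fin n) k)) b /
      algebraMap (MvPolynomial (Fin n) k) (FractionRing (MvPolynomial (Fin n) k)) a) Q = 0) :
    a ∣ b := by
  have halg : IsAlgebraic k (algebraMap (MvPolynomial (Fin n) k)
        (FractionRing (MvPolynomial (Fin n) k)) b /
      algebraMap (MvPolynomial (Fin n) k) (FractionRing (MvPolynomial (Fin n) k)) a) := ⟨Q, hQ, h⟩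
  -- Algebraic over the field k means integral over k, hence over k[x], which is integrally closed.
  have hint := halg.isIntegral.tower_top (A := MvPolynomial (Fin n) k)
  obtain ⟨r, hr⟩ := IsIntegrallyClosed.isIntegral_iff.1 hint
  have ha' : algebraMap (MvPolynomial (Fin n) k) (FractionRing (MvPolynomial (Fin n) k)) a ≠ 0 :=
    (map_ne_zero_iff _ (IsFractionRing.injective _ _)).2 ha
  refine ⟨r, IsFractionRing.injective _ (FractionRing (MvPolynomial (Fin n) k)) ?_⟩
  rw [map_mul, hr, mul_div_cancel₀ _ ha']

end Algebraic

/-! ### The Shestakov-Umirbaev inequality. -/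

section Cancellation

variable [LinearOrder Γ] {w : Fin n → Γ} {f g : MvPolynomial (Fin n) k}
  {d e N : Γ} {Φ : Polynomial (Polynomial k)}

theorem wdeg_lead (hf : wdeg w f = d) : wdeg w (lead w f) = d := by
  refine wdeg_eq_of_weightedHomogeneousComponent_ne_zero
    (wdeg_le_of_isWeightedHomogeneous (lead_isWeightedHomogeneous hf)) ?_
  rw [(lead_isWeightedHomogeneous hf).weightedHomogeneousComponent_same]
  exact lead_ne_zero fun h => by simp [h] at hf

variable [IsOrderedAddMonoid Γ]

theorem eq_C_mul_of_dvd_of_wdeg_eq (hw : ∀ i, 0 < w i) {a b : MvPolynomial (Fin n) k} {L : Γ}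
    (ha : wdeg w a = L) (hb : wdeg w b = L) (h : a ∣ b) : ∃ c, b = C c * a := by
  obtain ⟨r, rfl⟩ := h
  by_cases hr : ∃ c, r = C c
  · obtain ⟨c, rfl⟩ := hr
    exact ⟨c, mul_comm _ _⟩
  · push Not at hr
    obtain ⟨x, hx, hx0⟩ := wdeg_ne_bot_and_pos hw hr
    rw [wdeg_mul, ha, hx, ← WithBot.coe_add, WithBot.coe_inj] at hb
    exact absurd (add_eq_left.1 hb) hx0.ne'

/-- Along the progression of exponents, the top part at `lead w g` is a monomial in the two leading
forms times a one-variable polynomial Q in (g^w)^p / (f^w)^q. The quotient is thus algebraic over k,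
which gives divisibility; equality of degrees makes the factor constant. -/
theorem exists_lead_pow_eq_of_cancellation (hw : ∀ i, 0 < w i)
    (hf : wdeg w f = d) (hd : 0 < d) (hg : wdeg w g = e)
    (hN : ∀ i, wdeg w (Polynomial.aeval f (Φ.coeff i)) ≤ ((N - i • e : Γ) : WithBot Γ))
    (hT : topPair w f e N Φ ≠ 0) (hroot : (topPair w f e N Φ).eval (lead w g) = 0)
    {p q : ℕ} (hp : 0 < p) (hpq : p.Coprime q) (h : q • d = p • e) :
    ∃ c, lead w g ^ p = C c * lead w f ^ q := by
  have hF0 : lead w f ≠ 0 := lead_ne_zero fun h => by simp [h] at hf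
  refine eq_C_mul_of_dvd_of_wdeg_eq hw (L := p • e) (by rw [wdeg_pow (wdeg_lead hf), h])
    (wdeg_pow (wdeg_lead hg) p) ?_
  obtain ⟨i₀, ν₀, hi₀, hprog⟩ := exists_progression_topPair hf hd hN hT hp hpq h
  set T := topPair w f e N Φ
  set Q : Polynomial k := ∑ j ∈ T.support,
    Polynomial.monomial ((j - i₀) / p) (Φ.coeff j).leadingCoeff with hQ
  -- The constant term comes from the exponent i₀ alone, so Q is not zero.
  have hQ0 : Q.coeff 0 ≠ 0 := by
    rw [hQ, Polynomial.finsetSum_coeff, Finset.sum_eq_single_of_mem i₀ hi₀]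
    · simpa using (coeff_topPair hf hd hN (Polynomial.mem_support_iff.1 hi₀)).1
    · intro j hj hji
      obtain ⟨t, rfl, -⟩ := hprog j hj
      rw [Polynomial.coeff_monomial, if_neg]
      rw [Nat.add_sub_cancel_left, Nat.mul_div_cancel_left _ hp]
      rintro rfl
      simp at hji
  refine dvd_of_aeval_div_eq_zero (pow_ne_zero q hF0) (Q := Q)
    (fun h0 => hQ0 (by rw [h0, Polynomial.coeff_zero])) ?_
  set A := algebraMap (MvPolynomial (Fin n) k) (FractionRing (MvPolynomial (Fin n) k)) with hA
  have hAF : A (lead w f) ≠ 0 := (map_ne_zero_iff _ (IsFractionRing.injective _ _)).2 hF0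
  by_cases hG : lead w g = 0
  · have : g ≠ 0 := fun h => by simp [h] at hg
    exact absurd hG (lead_ne_zero this)
  have hAG : A (lead w g) ≠ 0 := (map_ne_zero_iff _ (IsFractionRing.injective _ _)).2 hG
  have key : A (T.eval (lead w g)) =
      A (lead w f) ^ ν₀ * A (lead w g) ^ i₀ *
        Polynomial.aeval (A (lead w g ^ p) / A (lead w f ^ q)) Q := by
    rw [Polynomial.eval_eq_sum, Polynomial.sum, map_sum, hQ, map_sum, Finset.mul_sum]
    refine Finset.sum_congr rfl fun j hj => ?_
    obtain ⟨t, hjt, hν⟩ := hprog j hj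
    rw [(coeff_topPair hf hd hN (Polynomial.mem_support_iff.1 hj)).2.2, Polynomial.aeval_monomial]
    have h1 : (j - i₀) / p = t := by
      rw [hjt, Nat.add_sub_cancel_left, Nat.mul_div_cancel_left _ hp]
    have h2 : algebraMap k (FractionRing (MvPolynomial (Fin n) k)) (Φ.coeff j).leadingCoeff =
        A (C (Φ.coeff j).leadingCoeff) := rfl
    rw [h1, h2, ← hν]
    generalize (Φ.coeff j).natDegree = ν
    rw [hjt]
    simp only [map_mul, map_pow, pow_add, pow_mul, div_pow]
    field_simp
  rw [hroot, map_zero] at key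
  rcases mul_eq_zero.1 key.symm with h0 | h0
  · exact absurd h0 (mul_ne_zero (pow_ne_zero _ hAF) (pow_ne_zero _ hAG))
  · exact h0

/-- More than m exponents in a progression of step p force one of them to be at least pm, and its
term alone has degree at least pm e. -/
theorem mul_le_of_pow_dvd_topPair [CharZero k] (hf : wdeg w f = d) (hd : 0 < d)
    (hg : wdeg w g = e) (he : 0 < e)
    (hN : ∀ i, wdeg w (Polynomial.aeval f (Φ.coeff i)) ≤ ((N - i • e : Γ) : WithBot Γ))
    (hT : topPair w f e N Φ ≠ 0) {p q m : ℕ} (hp : 0 < p) (hpq : p.Coprime q)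
    (h : q • d = p • e) (hm : (Polynomial.X - Polynomial.C (lead w g)) ^ m ∣ topPair w f e N Φ) :
    m • p • e ≤ N := by
  have hg0 : g ≠ 0 := fun h => by simp [h] at hg
  obtain ⟨i₀, ν₀, hi₀, hprog⟩ := exists_progression_topPair hf hd hN hT hp hpq h
  have hcard := lt_card_support_of_pow_dvd (lead_ne_zero (w := w) hg0) m _ hT hm
  have hex : ∃ j ∈ (topPair w f e N Φ).support, p * m ≤ j := by
    by_contra! hlt
    refine absurd hcard (not_lt.2 ?_)
    calc (topPair w f e N Φ).support.card
        = ((topPair w f e N Φ).support.image fun j => (j - i₀) / p).card := by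
          refine (Finset.card_image_of_injOn fun i hi j hj hij => ?_).symm
          obtain ⟨s, rfl, -⟩ := hprog i hi
          obtain ⟨t, rfl, -⟩ := hprog j hj
          simp only [Nat.add_sub_cancel_left, Nat.mul_div_cancel_left _ hp] at hij
          rw [hij]
      _ ≤ (Finset.range m).card := by
          refine Finset.card_le_card fun x hx => ?_
          obtain ⟨j, hj, rfl⟩ := Finset.mem_image.1 hx
          rw [Finset.mem_range, Nat.div_lt_iff_lt_mul hp, mul_comm]
          exact (Nat.sub_le _ _).trans_lt (hlt j hj)
      _ = m := Finset.card_range m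
  obtain ⟨j, hj, hjm⟩ := hex
  have h1 := (coeff_topPair hf hd hN (Polynomial.mem_support_iff.1 hj)).2.1
  rw [← h1, ← mul_nsmul', mul_comm m p]
  exact (nsmul_le_nsmul_left he.le hjm).trans (le_add_of_nonneg_left (nsmul_nonneg hd.le _))

/-- Compare deg df ∧ dΦ(f, g) ≤ deg f + deg Φ(f, g) with the chain rule, and iterate. -/
theorem wdeg_evalPair_iterate_derivative {D : Γ} (hf : wdeg w f = d)
    (hD : formDeg w (dWedge f g) = D) (m : ℕ) (Φ : Polynomial (Polynomial k)) :
    wdeg w (evalPair f g (Polynomial.derivative^[m] Φ)) + ((m • D : Γ) : WithBot Γ) ≤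
      wdeg w (evalPair f g Φ) + ((m • d : Γ) : WithBot Γ) := by
  induction m generalizing Φ with
  | zero => simp
  | succ m ih =>
    have h := formDeg_dWedge_le w f (evalPair f g Φ)
    rw [dWedge_evalPair, formDeg_smul, hD, hf] at h
    rw [Function.iterate_succ_apply, succ_nsmul, succ_nsmul, WithBot.coe_add, WithBot.coe_add,
      ← add_assoc, ← add_assoc]
    calc _ ≤ wdeg w (evalPair f g (Polynomial.derivative Φ)) + ((m • d : Γ) : WithBot Γ) + D := by
          exact add_le_add_left (ih _) _
      _ = wdeg w (evalPair f g (Polynomial.derivative Φ)) + D + ((m • d : Γ) : WithBot Γ) :=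
          add_right_comm _ _ _
      _ ≤ d + wdeg w (evalPair f g Φ) + ((m • d : Γ) : WithBot Γ) := by gcongr
      _ = _ := by rw [add_comm (d : WithBot Γ), add_right_comm]

/-- Lower bounds for the degree of `Φ(f, g)` and of its partial derivative with respect to `g`
when the leading terms of `Φ(f, g)` cancel. -/
theorem le_wdeg_of_cancellation [CharZero k] {D : Γ} (hf : wdeg w f = d) (hd : 0 < d)
    (hg : wdeg w g = e) (he : 0 < e) (hD : formDeg w (dWedge f g) = D) (hD0 : 0 < D)
    (hN : ∀ i, wdeg w (Polynomial.aeval f (Φ.coeff i)) ≤ ((N - i • e : Γ) : WithBot Γ))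
    (hT : topPair w f e N Φ ≠ 0) (hroot : (topPair w f e N Φ).eval (lead w g) = 0)
    {p q : ℕ} (hp : 0 < p) (hpq : p.Coprime q) (h : q • d = p • e) (hde : d + e ≤ p • e) :
    ((p • e + D - d - e : Γ) : WithBot Γ) ≤ wdeg w (evalPair f g Φ) ∧
    ((p • e - e : Γ) : WithBot Γ) ≤ wdeg w (evalPair f g (Polynomial.derivative Φ)) := by
  have hm0 : 0 < (topPair w f e N Φ).rootMultiplicity (lead w g) :=
    (Polynomial.rootMultiplicity_pos hT).2 hroot
  have hle := mul_le_of_pow_dvd_topPair hf hd hg he hN hT hp hpq h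
    (Polynomial.pow_rootMultiplicity_dvd _ (lead w g))
  -- Differentiating exactly as often as the multiplicity of the root removes the cancellation, so
  -- the derivative has the exact degree computed in `hdeg`.
  have hne : (Polynomial.derivative^[(topPair w f e N Φ).rootMultiplicity (lead w g)]
      (topPair w f e N Φ)).eval (lead w g) ≠ 0 := by
    rw [Polynomial.eval_iterate_derivative_rootMultiplicity, nsmul_eq_mul]
    exact mul_ne_zero (Nat.cast_ne_zero.2 (Nat.factorial_ne_zero _))
      (Polynomial.eval_divByMonic_pow_rootMultiplicity_ne_zero _ hT)
  obtain ⟨m, hm⟩ := Nat.exists_eq_succ_of_ne_zero hm0.ne'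
  rw [hm] at hle hne
  rw [iterate_derivative_topForm, Polynomial.iterate_derivative_map] at hne
  have hdeg : wdeg w (evalPair f g (Polynomial.derivative^[m.succ] Φ)) =
      ((N - m.succ • e : Γ) : WithBot Γ) := by
    refine (wdeg_evalPair_of_eval_topPair_ne_zero hg (fun i => ?_) hne).1
    rw [← coeff_map_aeval, ← Polynomial.iterate_derivative_map]
    exact wdeg_coeff_iterate_derivative_le (fun i => by rw [coeff_map_aeval]; exact hN i) _ i
  have h1 := wdeg_evalPair_iterate_derivative hf hD m.succ Φ
  have h2 := wdeg_evalPair_iterate_derivative hf hD m (Polynomial.derivative Φ)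
  rw [← Function.iterate_succ_apply] at h2
  rw [hdeg, ← WithBot.coe_add] at h1 h2
  generalize p • e = L at *
  -- The bounds obtained carry m extra copies of L + D - d - e; being nonnegative, these can be
  -- dropped.
  have hmm : m • (d + e) ≤ m • (L + D) :=
    nsmul_le_nsmul_right (hde.trans (le_add_of_nonneg_right hD0.le)) m
  simp only [Nat.succ_eq_add_one, succ_nsmul, nsmul_add] at h1 h2 hle hmm
  constructor
  · rcases hx : wdeg w (evalPair f g Φ) with _ | x
    · rw [hx] at h1
      exact absurd h1 (not_le.2 (WithBot.bot_lt_coe _))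
    · rw [hx] at h1
      replace h1 := WithBot.coe_le_coe.1 h1
      refine WithBot.coe_le_coe.2 ?_
      generalize m • d = md at *
      generalize m • e = me at *
      generalize m • D = mD at *
      generalize m • L = mL at *
      grind
  · rcases hx : wdeg w (evalPair f g (Polynomial.derivative Φ)) with _ | x
    · rw [hx] at h2
      exact absurd h2 (not_le.2 (WithBot.bot_lt_coe _))
    · rw [hx] at h2
      replace h2 := WithBot.coe_le_coe.1 h2
      refine WithBot.coe_le_coe.2 ?_
      generalize m • d = md at *
      generalize m • e = me at *
      generalize m • D = mD at *
      generalize m • L = mL at *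
      grind

end Cancellation

/-! ### The inequality for pairs with independent leading forms. -/

section Pairs

variable [LinearOrder Γ] [IsOrderedAddMonoid Γ] {w : Fin n → Γ} {f g : MvPolynomial (Fin n) k}
  {d e N D : Γ} {Φ : Polynomial (Polynomial k)}

theorem C_mul_mem {A : Subalgebra k (MvPolynomial (Fin n) k)} (c : k) (hf : f ∈ A) :
    C c * f ∈ A :=
  A.mul_mem (A.algebraMap_mem c) hf

theorem mem_adjoin_of_eq_C_mul {h : MvPolynomial (Fin n) k} {c : k} (hg : g ≠ 0)
    (h' : g = C c * h) {A : Subalgebra k (MvPolynomial (Fin n) k)} (hA : g ∈ A) : h ∈ A := by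
  have hc : c ≠ 0 := by
    rintro rfl
    exact hg (by rw [h', C_0, zero_mul])
  have : h = C c⁻¹ * g := by
    rw [h', ← mul_assoc, ← C_mul, inv_mul_cancel₀ hc, C_1, one_mul]
  rw [this]
  exact C_mul_mem _ hA

/-- If p or q were 1, the relation between (g^w)^p and (f^w)^q would put one leading form in the
algebra generated by the other. With p, q ≥ 2, the common value qd = pe is at least 2d and 2e, hence
at least d + e. -/
theorem le_wdeg_and_of_cancellation [CharZero k] (hw : ∀ i, 0 < w i) (hf : wdeg w f = d)
    (hd : 0 < d) (hg : wdeg w g = e) (he : 0 < e) (hD : formDeg w (dWedge f g) = D) (hD0 : 0 < D)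
    (hgf : lead w g ∉ Algebra.adjoin k {lead w f}) (hfg : lead w f ∉ Algebra.adjoin k {lead w g})
    (hN : ∀ i, wdeg w (Polynomial.aeval f (Φ.coeff i)) ≤ ((N - i • e : Γ) : WithBot Γ))
    (hT : topPair w f e N Φ ≠ 0) (hroot : (topPair w f e N Φ).eval (lead w g) = 0) :
    ∃ p q : ℕ, 2 ≤ p ∧ 2 ≤ q ∧ p.Coprime q ∧ q • d = p • e ∧ d + e ≤ p • e ∧
      (∃ c, lead w g ^ p = C c * lead w f ^ q) ∧
      ((p • e + D - d - e : Γ) : WithBot Γ) ≤ wdeg w (evalPair f g Φ) ∧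
      ((p • e - e : Γ) : WithBot Γ) ≤ wdeg w (evalPair f g (Polynomial.derivative Φ)) := by
  obtain ⟨p, q, hp, hq, hpq, h⟩ := exists_coprime_of_cancellation hf hd hg he hN hT hroot
  obtain ⟨c, hc⟩ := exists_lead_pow_eq_of_cancellation hw hf hd hg hN hT hroot hp hpq h
  have hp2 : 2 ≤ p := by
    by_contra! hlt
    obtain rfl : p = 1 := by omega
    refine hgf ?_
    rw [← pow_one (lead w g), hc]
    exact C_mul_mem _ (Subalgebra.pow_mem _ (Algebra.self_mem_adjoin_singleton k _) _)
  have hq2 : 2 ≤ q := by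
    by_contra! hlt
    obtain rfl : q = 1 := by omega
    rw [pow_one] at hc
    have hg0 : g ≠ 0 := fun h => by simp [h] at hg
    exact hfg (mem_adjoin_of_eq_C_mul (pow_ne_zero p (lead_ne_zero hg0)) hc
      (Subalgebra.pow_mem _ (Algebra.self_mem_adjoin_singleton k _) _))
  have hde : d + e ≤ p • e := by
    have h1 := nsmul_le_nsmul_left he.le hp2
    have h2 := nsmul_le_nsmul_left hd.le hq2
    rw [h] at h2
    rw [two_nsmul] at h1 h2
    grind
  obtain ⟨h1, h2⟩ := le_wdeg_of_cancellation hf hd hg he hD hD0 hN hT hroot hp hpq h hde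
  exact ⟨p, q, hp2, hq2, hpq, h, hde, ⟨c, hc⟩, h1, h2⟩

theorem map_aeval_ne_zero (hf : wdeg w f = d) (hd : 0 < d) (hΦ : Φ ≠ 0) :
    Φ.map (Polynomial.aeval f).toRingHom ≠ 0 := by
  obtain ⟨i, hi⟩ := Polynomial.support_nonempty.2 hΦ
  intro h0
  have h1 := congrArg (fun P => Polynomial.coeff P i) h0
  simp only [coeff_map_aeval, Polynomial.coeff_zero] at h1
  have h2 := (wdeg_aeval_and_lead_aeval hf hd (Polynomial.mem_support_iff.1 hi)).1
  rw [h1, wdeg_zero] at h2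
  exact WithBot.bot_ne_coe h2

end Pairs

/-! ### Triples and elementary automorphisms. -/

section Triples

variable [LinearOrder Γ] {w : Fin n → Γ}

theorem exists_wdeg_eq_of_mem_triples [IsOrderedAddMonoid Γ] (hw : ∀ i, 0 < w i)
    {F : Fin 3 → MvPolynomial (Fin n) k} (hF : F ∈ triples k n) (i : Fin 3) :
    ∃ a : Γ, wdeg w (F i) = a ∧ 0 < a := by
  refine wdeg_ne_bot_and_pos hw fun c hc => ?_
  have h : Transcendental k (F i) := AlgebraicIndependent.transcendental hF i
  rw [hc] at h
  exact h (isAlgebraic_algebraMap c)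

theorem comp_mem_triples {F : Fin 3 → MvPolynomial (Fin n) k} (hF : F ∈ triples k n)
    (E : MvPolynomial (Fin 3) k ≃ₐ[k] MvPolynomial (Fin 3) k) : comp F E ∈ triples k n := by
  have h : aeval (comp F E) = (aeval F).comp (E : MvPolynomial (Fin 3) k →ₐ[k] _) := by
    ext1 i
    simp [comp]
  change AlgebraicIndependent k _
  rw [algebraicIndependent_iff_injective_aeval, h]
  exact (algebraicIndependent_iff_injective_aeval.1 hF).comp E.injective

/-- The elementary automorphism `y_l ↦ y_l + u(y_j)`. -/
theorem exists_mem_elementaryAt {l j : Fin 3} (hlj : j ≠ l) (u : Polynomial k) :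
    ∃ E ∈ elementaryAt k l, E (X l) = X l + Polynomial.aeval (X j) u ∧
      ∀ i, i ≠ l → E (X i) = X i := by
  let A (v : Polynomial k) : MvPolynomial (Fin 3) k →ₐ[k] MvPolynomial (Fin 3) k :=
    aeval (Function.update X l (X l + Polynomial.aeval (X j) v))
  have hA1 : ∀ v i, i ≠ l → A v (X i) = X i := fun v i hi => by simp [A, hi]
  have hA0 : ∀ v, A v (X l) = X l + Polynomial.aeval (X j) v := fun v => by simp [A]
  have hA2 : ∀ v v', A v (Polynomial.aeval (X j) v') = Polynomial.aeval (X j) v' := fun v v' => by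
    rw [← Polynomial.aeval_algHom_apply, hA1 v j hlj]
  have hcomp : ∀ v, (A v).comp (A (-v)) = AlgHom.id k _ := fun v => by
    ext1 i
    by_cases hi : i = l
    · subst hi
      rw [AlgHom.comp_apply, hA0, map_add, hA0, hA2, map_neg, add_neg_cancel_right, AlgHom.id_apply]
    · rw [AlgHom.comp_apply, hA1 _ i hi, hA1 _ i hi, AlgHom.id_apply]
  refine ⟨AlgEquiv.ofAlgHom (A u) (A (-u)) (hcomp u) (by simpa using hcomp (-u)),
    ⟨⟨l, Polynomial.aeval (X j) u, ?_, hA0 u, hA1 u⟩, hA1 u⟩, hA0 u, hA1 u⟩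
  have hX : (X j : MvPolynomial (Fin 3) k) ∈ supported k ({l}ᶜ : Set (Fin 3)) :=
    X_mem_supported.2 hlj
  exact Algebra.adjoin_le (Set.singleton_subset_iff.2 hX)
    (Polynomial.aeval_mem_adjoin_singleton k _)

end Triples

/-! ### Numerical consequences of the quasi SU condition. -/

section QuasiSU

variable [LinearOrder Γ] [IsOrderedAddMonoid Γ] {w : Fin n → Γ}
  {F G : Fin 3 → MvPolynomial (Fin n) k}

theorem QuasiSUCondition.exists_degrees [CharZero k] (hw : ∀ i, 0 < w i) (hF : F ∈ triples k n)
    (hG : G ∈ triples k n) (h : QuasiSUCondition w F G) :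
    ∃ (d e D x : Γ) (s : ℕ), wdeg w (G 1) = d ∧ wdeg w (G 0) = e ∧ wdeg w (F 2) = x ∧
      0 < d ∧ 0 < D ∧ 0 < x ∧ Odd s ∧ 3 ≤ s ∧ s • d = 2 • e ∧
      (∃ c, lead w (G 0) ^ 2 = C c * lead w (G 1) ^ s) ∧ e + D ≤ x + d ∧
      ((e + D : Γ) : WithBot Γ) ≤ formDeg w (dWedge (G 1) (F 2)) := by
  obtain ⟨e, he, he0⟩ := exists_wdeg_eq_of_mem_triples hw hG 0
  obtain ⟨d, hd, hd0⟩ := exists_wdeg_eq_of_mem_triples hw hG 1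
  obtain ⟨x, hx, hx0⟩ := exists_wdeg_eq_of_mem_triples hw hF 2
  obtain ⟨y, hy, -⟩ := exists_wdeg_eq_of_mem_triples hw hG 2
  have h6 := h.su6
  obtain ⟨D, hD⟩ : ∃ D : Γ, formDeg w (dWedge (G 0) (G 1)) = D := by
    rcases hD : formDeg w (dWedge (G 0) (G 1)) with _ | D
    · rw [hD, he] at h6
      exact absurd h6 (not_lt.2 bot_le)
    · exact ⟨D, rfl⟩
  have hD0 := formDeg_pos hw hD
  have hD' : formDeg w (dWedge (G 1) (G 0)) = D := by rw [dWedge_swap, formDeg_neg, hD]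
  rw [hy, hd, he, hD, ← WithBot.coe_add, ← WithBot.coe_add, WithBot.coe_lt_coe] at h6
  have h3 := h.su3'.1
  rw [hd, he, WithBot.coe_lt_coe] at h3
  have h4 := h.su4.1
  rw [hx, he, WithBot.coe_le_coe] at h4
  obtain ⟨Φ, hΦ⟩ : ∃ Φ, F 2 - G 2 = evalPair (G 1) (G 0) Φ := by
    refine mem_adjoin_pair_iff.1 ?_
    rw [Set.pair_comm, ← neg_sub]
    exact neg_mem h.su1'.2.2
  have hlt : wdeg w (-G 2) < wdeg w (F 2) := by
    rw [wdeg_neg]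
    exact h.su5
  have hΦdeg : wdeg w (evalPair (G 1) (G 0) Φ) = x := by
    rw [← hΦ, sub_eq_add_neg, wdeg_add_eq_of_lt hlt, hx]
  have hΦlead : lead w (evalPair (G 1) (G 0) Φ) = lead w (F 2) := by
    rw [← hΦ, sub_eq_add_neg, lead_add_of_lt hlt]
  have hΦ0 : Φ ≠ 0 := by
    rintro rfl
    simp [evalPair] at hΦdeg
  obtain ⟨N, hN, hT⟩ := exists_topForm_ne_zero w e (map_aeval_ne_zero hd hd0 hΦ0)
  simp only [coeff_map_aeval] at hN
  -- Without cancellation the leading form of `F 2` would lie in the algebra excluded by `su4`.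
  have hroot : (topPair w (G 1) e N Φ).eval (lead w (G 0)) = 0 := by
    by_contra hne
    refine h.su4.2 ?_
    rw [← hΦlead, (wdeg_evalPair_of_eval_topPair_ne_zero he hN hne).2, Set.pair_comm]
    exact eval_topPair_mem_adjoin hd hd0 hN
  have hG1 : G 1 ≠ 0 := fun h => by simp [h] at hd
  have hnot : lead w (G 1) ∉ Algebra.adjoin k {lead w (G 0)} := by
    intro hmem
    obtain ⟨c, j, -, hj⟩ := eq_C_mul_pow_of_mem_adjoin (lead_isWeightedHomogeneous he) he0
      (lead_isWeightedHomogeneous hd) (lead_ne_zero hG1) hmem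
    rcases Nat.eq_zero_or_pos j with rfl | hj0
    · rw [zero_nsmul] at hj
      exact hd0.ne hj
    · have := nsmul_le_nsmul_left he0.le (Nat.succ_le_of_lt hj0)
      rw [hj, Nat.succ_eq_add_one, zero_add, one_nsmul] at this
      exact absurd h3 (not_lt.2 this)
  obtain ⟨p, q, hp, hq, hpq, hqp, -, hc, hb1, hb2⟩ :=
    le_wdeg_and_of_cancellation hw hd hd0 he he0 hD' hD0 h.su3'.2 hnot hN hT hroot
  rw [hΦdeg, WithBot.coe_le_coe] at hb1
  -- For p ≥ 3 the inequality would give 2e + D - d ≤ x ≤ e, against d < e and D > 0.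
  obtain rfl : p = 2 := by
    by_contra hp2
    have := nsmul_le_nsmul_left he0.le (show 3 ≤ p by omega)
    rw [succ_nsmul, two_nsmul] at this
    grind
  have hodd : Odd q := by
    rwa [Nat.coprime_two_left] at hpq
  have hq3 : 3 ≤ q := by
    obtain ⟨r, rfl⟩ := hodd
    omega
  rw [two_nsmul] at hb1 hb2
  refine ⟨d, e, D, x, q, hd, he, hx, hd0, hD0, hx0, hodd, hq3, hqp, hc, by grind, ?_⟩
  have hform : evalPair (G 1) (G 0) (Polynomial.derivative Φ) • dWedge (G 1) (G 0) =
      dWedge (G 1) (F 2) - dWedge (G 1) (G 2) := by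
    rw [← dWedge_evalPair, ← hΦ]
    simp only [← dWedgeDerivation_apply, map_sub]
  have h1 := formDeg_sub_le w (dWedge (G 1) (F 2)) (dWedge (G 1) (G 2))
  rw [← hform, formDeg_smul, hD'] at h1
  have h2 : ((e + D : Γ) : WithBot Γ) ≤
      wdeg w (evalPair (G 1) (G 0) (Polynomial.derivative Φ)) + D := by
    rw [WithBot.coe_add]
    gcongr
    simpa using hb2
  rcases le_max_iff.1 (h2.trans h1) with h5 | h5
  · exact h5
  -- The form dg_2 ∧ dg_3 is too small to carry the degree e + D, by `su6`.
  · have := h5.trans (formDeg_dWedge_le w _ _)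
    rw [hd, hy, ← WithBot.coe_add, WithBot.coe_le_coe] at this
    grind

end QuasiSU

/-! ### The shape of g_2 - f_2 and g_1 - f_1. -/

section QuasiSU

variable [LinearOrder Γ] [IsOrderedAddMonoid Γ] {w : Fin n → Γ}
  {F G : Fin 3 → MvPolynomial (Fin n) k} {d e D x : Γ} {s : ℕ}

/-- From 3d ≤ 2e and e < x + d one gets 3d < 2x + 2d. -/
theorem lt_two_nsmul_of_le (hd : 0 < d) (hD : 0 < D) (hs : 3 ≤ s) (hsd : s • d = 2 • e)
    (hx : e + D ≤ x + d) : d < 2 • x := by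
  have h := nsmul_le_nsmul_left hd.le hs
  rw [hsd, succ_nsmul, two_nsmul, two_nsmul] at h
  rw [two_nsmul]
  grind

theorem aeval_eq_of_natDegree_le_one {f : MvPolynomial (Fin n) k} {u : Polynomial k}
    (hu : u.natDegree ≤ 1) : Polynomial.aeval f u = C (u.coeff 1) * f + C (u.coeff 0) := by
  conv_lhs => rw [Polynomial.eq_X_add_C_of_natDegree_le_one hu]
  simp [algebraMap_eq]

theorem QuasiSUCondition.exists_eq_add_mul (h : QuasiSUCondition w F G)
    (hd : wdeg w (G 1) = d) (hx : wdeg w (F 2) = x) (hd0 : 0 < d) (hx0 : 0 < x)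
    (hdx : d < 2 • x) :
    ∃ b e₀ : k, G 1 = F 1 + C b * F 2 + C e₀ ∧ (b ≠ 0 → x ≤ d) ∧ wdeg w (F 1) = d := by
  have hG1 : G 1 ≠ 0 := fun h => by simp [h] at hd
  obtain ⟨u, hu⟩ : ∃ u : Polynomial k, G 1 - F 1 = Polynomial.aeval (F 2) u := by
    have := h.su1'.2.1
    rw [Algebra.adjoin_singleton_eq_range_aeval] at this
    obtain ⟨u, hu⟩ := this
    exact ⟨u, hu.symm⟩
  have hG : G 1 = Polynomial.aeval (F 2) u + F 1 := by rw [← hu, sub_add_cancel]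
  by_cases hu0 : u = 0
  · rw [hu0, map_zero, zero_add] at hG
    exact ⟨0, 0, by simp [hG], fun h => absurd rfl h, by rw [← hG, hd]⟩
  obtain ⟨hdeg, hlead⟩ := wdeg_aeval_and_lead_aeval hx hx0 hu0
  have hle : u.natDegree • x ≤ d := by
    have h1 := wdeg_sub_le w (G 1) (F 1)
    rw [hu, hdeg, max_eq_left h.su2'.2, hd, WithBot.coe_le_coe] at h1
    exact h1
  have hu1 : u.natDegree ≤ 1 := by
    by_contra! hlt
    exact absurd ((nsmul_le_nsmul_left hx0.le hlt).trans hle) (not_le.2 hdx)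
  refine ⟨u.coeff 1, u.coeff 0, ?_, fun hb => ?_, ?_⟩
  · rw [hG, aeval_eq_of_natDegree_le_one hu1]
    ring
  · have := nsmul_le_nsmul_left hx0.le (Polynomial.le_natDegree_of_ne_zero hb)
    rw [one_nsmul] at this
    exact this.trans hle
  -- If `F 1` had smaller degree, `lead w (G 1)` would be a multiple of `lead w (F 2)`, which `su4`
  -- forbids.
  · by_contra hne
    have hlt : wdeg w (F 1) < d := lt_of_le_of_ne (h.su2'.2.trans_eq hd) hne
    have hdeg' : u.natDegree • x = d := by
      refine le_antisymm hle (WithBot.coe_le_coe.1 ?_)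
      have h1 := wdeg_add_le w (Polynomial.aeval (F 2) u) (F 1)
      rw [← hG, hd, hdeg] at h1
      rcases le_max_iff.1 h1 with h2 | h2
      · exact h2
      · exact absurd hlt (not_lt.2 h2)
    have hl : lead w (G 1) = C u.leadingCoeff * lead w (F 2) ^ u.natDegree := by
      rw [← hlead, hG, lead_add_of_lt]
      rwa [hdeg, hdeg']
    have hu1' : u.natDegree = 1 := by
      rcases Nat.le_one_iff_eq_zero_or_eq_one.1 hu1 with h0 | h0
      · rw [h0, zero_nsmul] at hdeg'
        exact absurd hdeg' hd0.ne
      · exact h0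
    rw [hu1', pow_one] at hl
    exact h.su4.2 (mem_adjoin_of_eq_C_mul (lead_ne_zero hG1) hl (Algebra.subset_adjoin (by simp)))

/-- If f_3^w were a polynomial in f_2^w, then g_2^w would be a nonzero multiple of f_2^w: for b ≠ 0
the bound x ≤ d leaves only the first power. Then f_3^w would lie in k[g_2^w], against `su4`. -/
theorem QuasiSUCondition.lead_two_notMem (h : QuasiSUCondition w F G)
    (hd : wdeg w (G 1) = d) (hx : wdeg w (F 2) = x) (hf : wdeg w (F 1) = d) (hd0 : 0 < d)
    (hx0 : 0 < x) {b e₀ : k} (hG : G 1 = F 1 + C b * F 2 + C e₀) (hb : b ≠ 0 → x ≤ d) :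
    lead w (F 2) ∉ Algebra.adjoin k {lead w (F 1)} := by
  have hF2 : F 2 ≠ 0 := fun h => by simp [h] at hx
  have hG1 : G 1 ≠ 0 := fun h => by simp [h] at hd
  intro hmem
  obtain ⟨c, j, hc, hj⟩ := eq_C_mul_pow_of_mem_adjoin (lead_isWeightedHomogeneous hf) hd0
    (lead_isWeightedHomogeneous hx) (lead_ne_zero hF2) hmem
  have he₀ : wdeg w (C e₀ : MvPolynomial (Fin n) k) < d :=
    (wdeg_C_le w e₀).trans_lt (WithBot.coe_lt_coe.2 hd0)
  obtain ⟨c', hc'⟩ : ∃ c', lead w (G 1) = C c' * lead w (F 1) := by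
    by_cases hb0 : b = 0
    · rw [hb0, C_0, zero_mul, add_zero] at hG
      exact ⟨1, by rw [hG, lead_add_of_lt (by rwa [hf]), C_1, one_mul]⟩
    · have hj1 : j = 1 := by
        rcases lt_trichotomy j 1 with h0 | h0 | h0
        · rw [Nat.lt_one_iff.1 h0, zero_nsmul] at hj
          exact absurd hj hx0.ne
        · exact h0
        · have := nsmul_lt_nsmul_left hd0 h0
          rw [one_nsmul, hj] at this
          exact absurd (hb hb0) (not_le.2 this)
      rw [hj1, one_nsmul] at hj
      rw [hj1, pow_one] at hc
      refine ⟨1 + b * c, ?_⟩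
      rw [lead_eq hd, hG, map_add, map_add, weightedHomogeneousComponent_eq_zero_of_wdeg_lt he₀,
        weightedHomogeneousComponent_C_mul, ← lead_eq hf, ← lead_eq (hx.trans (by rw [hj])), hc]
      simp only [C_add, C_1, C_mul]
      ring
  refine h.su4.2 ?_
  rw [hc]
  refine C_mul_mem _ (Subalgebra.pow_mem _ ?_ _)
  exact mem_adjoin_of_eq_C_mul (lead_ne_zero hG1) hc' (Algebra.subset_adjoin (by simp))

theorem lead_one_notMem (hx : wdeg w (F 2) = x) (hf : wdeg w (F 1) = d) (hd0 : 0 < d)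
    (hx0 : 0 < x) (hdx : d < 2 • x) (hnot : lead w (F 2) ∉ Algebra.adjoin k {lead w (F 1)}) :
    lead w (F 1) ∉ Algebra.adjoin k {lead w (F 2)} := by
  have hF1 : F 1 ≠ 0 := fun h => by simp [h] at hf
  intro hmem
  obtain ⟨c, j, hc, hj⟩ := eq_C_mul_pow_of_mem_adjoin (lead_isWeightedHomogeneous hx) hx0
    (lead_isWeightedHomogeneous hf) (lead_ne_zero hF1) hmem
  rcases lt_trichotomy j 1 with h0 | h0 | h0
  · rw [Nat.lt_one_iff.1 h0, zero_nsmul] at hj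
    exact hd0.ne hj
  · rw [h0, pow_one] at hc
    exact hnot (mem_adjoin_of_eq_C_mul (lead_ne_zero hF1) hc
      (Algebra.self_mem_adjoin_singleton k _))
  · have := nsmul_le_nsmul_left hx0.le h0
    rw [Nat.succ_eq_add_one, one_add_one_eq_two, hj] at this
    exact absurd hdx (not_lt.2 this)

theorem evalPair_eq_of_natDegree_le (f g : MvPolynomial (Fin n) k) {Ψ : Polynomial (Polynomial k)}
    (h1 : (Ψ.coeff 1).natDegree = 0) (h2 : (Ψ.coeff 2).natDegree = 0)
    (h3 : ∀ i, 3 ≤ i → Ψ.coeff i = 0) :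
    evalPair f g Ψ = Polynomial.aeval f (Ψ.coeff 0) + C ((Ψ.coeff 1).coeff 0) * g +
      C ((Ψ.coeff 2).coeff 0) * g ^ 2 := by
  have hdeg : (Ψ.map (Polynomial.aeval f).toRingHom).natDegree < 3 := by
    refine Nat.lt_succ_of_le (Polynomial.natDegree_le_iff_coeff_eq_zero.2 fun i hi => ?_)
    rw [coeff_map_aeval, h3 i hi, map_zero]
  have hconst : ∀ u : Polynomial k, u.natDegree = 0 → Polynomial.aeval f u = C (u.coeff 0) := by
    intro u hu
    conv_lhs => rw [Polynomial.eq_C_of_natDegree_eq_zero hu]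
    simp [algebraMap_eq]
  rw [evalPair, Polynomial.eval_eq_sum_range' hdeg]
  simp only [Finset.sum_range_succ, Finset.sum_range_zero, coeff_map_aeval, hconst _ h1,
    hconst _ h2, zero_add, pow_zero, mul_one, pow_one]

theorem QuasiSUCondition.exists_eq_add_aeval [CharZero k] (hw : ∀ i, 0 < w i)
    (h : QuasiSUCondition w F G) (he : wdeg w (G 0) = e) (hx : wdeg w (F 2) = x)
    (hf : wdeg w (F 1) = d) (hd0 : 0 < d) (hD0 : 0 < D) (hx0 : 0 < x) (hs : 3 ≤ s)
    (hsd : s • d = 2 • e) (hxd : e + D ≤ x + d)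
    (hnot : lead w (F 2) ∉ Algebra.adjoin k {lead w (F 1)})
    (hform : ((e + D : Γ) : WithBot Γ) ≤ formDeg w (dWedge (F 1) (F 2))) :
    ∃ (φ : Polynomial k) (a c : k), 2 * φ.natDegree ≤ s ∧
      G 0 = F 0 + Polynomial.aeval (F 1) φ + C c * F 2 + C a * F 2 ^ 2 := by
  have hdx := lt_two_nsmul_of_le hd0 hD0 hs hsd hxd
  obtain ⟨Ψ, hΨ⟩ := mem_adjoin_pair_iff.1 h.su1'.1
  have hG : G 0 = F 0 + evalPair (F 1) (F 2) Ψ := by rw [← hΨ, add_sub_cancel]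
  have hΨdeg : wdeg w (evalPair (F 1) (F 2) Ψ) ≤ e := by
    rw [← hΨ]
    exact (wdeg_sub_le w _ _).trans (max_le he.le (h.su2'.1.trans_eq he))
  -- Once every term has degree at most e, the inequality e < x + d excludes mixed terms, and d < 2x
  -- excludes cubes of `F 2`.
  suffices hbound : ∀ i, Ψ.coeff i ≠ 0 → (Ψ.coeff i).natDegree • d + i • x ≤ e by
    have hxd' : e < x + d := (lt_add_of_pos_right e hD0).trans_le hxd
    have hconst : ∀ i, 1 ≤ i → (Ψ.coeff i).natDegree = 0 := by
      intro i hi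
      by_cases h0 : Ψ.coeff i = 0
      · rw [h0, Polynomial.natDegree_zero]
      by_contra hne
      have h1 := nsmul_le_nsmul_left hd0.le (Nat.one_le_iff_ne_zero.2 hne)
      have h2 := nsmul_le_nsmul_left hx0.le hi
      have h3 := hbound i h0
      rw [one_nsmul] at h1 h2
      grind
    have hzero : ∀ i, 3 ≤ i → Ψ.coeff i = 0 := by
      intro i hi
      by_contra h0
      have h1 := nsmul_le_nsmul_left hx0.le hi
      have h2 := nsmul_nonneg hd0.le (Ψ.coeff i).natDegree
      have h3 := hbound i h0
      have h4 := nsmul_le_nsmul_left hd0.le hs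
      rw [hsd] at h4
      rw [succ_nsmul, two_nsmul] at h1 h4
      rw [two_nsmul] at hdx h4
      grind
    refine ⟨Ψ.coeff 0, (Ψ.coeff 2).coeff 0, (Ψ.coeff 1).coeff 0, ?_, ?_⟩
    · by_cases h0 : Ψ.coeff 0 = 0
      · simp [h0]
      · have h1 := hbound 0 h0
        rw [zero_nsmul, add_zero] at h1
        refine (nsmul_left_strictMono hd0).le_iff_le.1 ?_
        rw [hsd, mul_nsmul']
        exact nsmul_le_nsmul_right h1 2
    · rw [hG, evalPair_eq_of_natDegree_le _ _ (hconst 1 le_rfl) (hconst 2 (by norm_num)) hzero]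
      ring
  intro i hi
  have hΨ0 : Ψ ≠ 0 := by
    rintro rfl
    simp at hi
  obtain ⟨N, hN, hT⟩ := exists_topForm_ne_zero w x (map_aeval_ne_zero hf hd0 hΨ0)
  simp only [coeff_map_aeval] at hN
  by_cases hroot : (topPair w (F 1) x N Ψ).eval (lead w (F 2)) = 0
  · exfalso
    rcases hD' : formDeg w (dWedge (F 1) (F 2)) with _ | D'
    · rw [hD'] at hform
      exact absurd hform (not_le.2 (WithBot.bot_lt_coe _))
    rw [hD'] at hform
    replace hform := WithBot.coe_le_coe.1 hform
    obtain ⟨p, q, -, -, -, -, hle, -, hb1, -⟩ := le_wdeg_and_of_cancellation hw hf hd0 hx hx0 hD'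
      (formDeg_pos hw hD') hnot (lead_one_notMem hx hf hd0 hx0 hdx hnot) hN hT hroot
    have h1 := WithBot.coe_le_coe.1 (hb1.trans hΨdeg)
    grind
  · have hdeg := (wdeg_evalPair_of_eval_topPair_ne_zero hx hN hroot).1
    rw [hdeg, WithBot.coe_le_coe] at hΨdeg
    have h1 := hN i
    rw [(wdeg_aeval_and_lead_aeval hf hd0 hi).1, WithBot.coe_le_coe, le_sub_iff_add_le] at h1
    exact h1.trans hΨdeg

theorem exists_aeval_eq_aeval_add (hd0 : 0 < d) (hD0 : 0 < D) (hsd : s • d = 2 • e)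
    (hxd : e + D ≤ x + d) {f₁ f₂ g : MvPolynomial (Fin n) k} {b e₀ : k}
    (hg : g = f₁ + C b * f₂ + C e₀) (hb : b ≠ 0 → x ≤ d) {φ : Polynomial k}
    (hφ : 2 * φ.natDegree ≤ s) : ∃ (ψ : Polynomial k) (c : k), 2 * ψ.natDegree ≤ s ∧
      Polynomial.aeval f₁ φ = Polynomial.aeval g ψ + C c * f₂ := by
  have hf₁ : Polynomial.aeval g (Polynomial.X - Polynomial.C e₀) = f₁ + C b * f₂ := by
    rw [map_sub, Polynomial.aeval_X, Polynomial.aeval_C, algebraMap_eq, hg, add_sub_cancel_right]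
  refine ⟨φ.comp (Polynomial.X - Polynomial.C e₀), -(φ.coeff 1 * b),
    by rwa [Polynomial.natDegree_comp, Polynomial.natDegree_X_sub_C, mul_one], ?_⟩
  rw [Polynomial.aeval_comp, hf₁]
  by_cases hb0 : b = 0
  · simp [hb0]
  · have hs : s < 4 := by
      by_contra! hs4
      have h1 := nsmul_le_nsmul_left hd0.le hs4
      have h2 := hb hb0
      rw [hsd, show 4 = 2 + 2 from rfl, add_nsmul, two_nsmul, two_nsmul] at h1
      grind
    rw [aeval_eq_of_natDegree_le_one (by omega), aeval_eq_of_natDegree_le_one (by omega)]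
    simp only [C_neg, C_mul]
    ring

end QuasiSU

section Main

variable [LinearOrder Γ] [IsOrderedAddMonoid Γ] {w : Fin n → Γ}
  {F G : Fin 3 → MvPolynomial (Fin n) k} {d e D x : Γ} {s : ℕ}

theorem approx_of_eq_C_mul {f g : MvPolynomial (Fin n) k} {c : k} (h : f = C c * g) :
    Approx f g := by
  intro hli
  have := (LinearIndependent.pair_iff.1 hli 1 (-c) (by
    rw [one_smul, neg_smul, smul_eq_C_mul, h, add_neg_cancel])).1
  exact one_ne_zero this

theorem dWedge_sub_aeval_add_C (f g : MvPolynomial (Fin n) k) (u : Polynomial k) (c : k) :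
    dWedge (f - Polynomial.aeval g u) (g + C c) = dWedge f g := by
  have hC : ∀ h : MvPolynomial (Fin n) k, dWedge h (C c) = 0 := fun h => by
    rw [← dWedgeDerivation_apply]
    exact Derivation.map_algebraMap _ _
  have hu : dWedge g (Polynomial.aeval g u) = 0 := by rw [dWedge_aeval_right, dWedge_self, smul_zero]
  rw [dWedge_add_right, hC, add_zero, dWedge_swap g, dWedge_swap g f, ← dWedgeDerivation_apply,
    map_sub, dWedgeDerivation_apply, dWedgeDerivation_apply, hu, sub_zero]

theorem QuasiSUCondition.exists_suCondition [CharZero k] (hw : ∀ i, 0 < w i)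
    (hF : F ∈ triples k n) (hG : G ∈ triples k n) (h : QuasiSUCondition w F G) :
    ∃ E₁ ∈ elementaryAt k 0, ∃ E₂ ∈ elementaryAt k 1,
      tupleDeg w (comp G E₁) = tupleDeg w G ∧ comp (comp G E₁) E₂ ∈ triples k n ∧
      SUCondition w F (comp (comp G E₁) E₂) := by
  obtain ⟨d, e, D, x, s, hd, he, hx, hd0, hD0, hx0, hodd, hs, hsd, ⟨c₀, hc₀⟩, hxd, hform⟩ :=
    h.exists_degrees hw hF hG
  have hdx := lt_two_nsmul_of_le hd0 hD0 hs hsd hxd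
  obtain ⟨b, e₀, hG1, hb, hf⟩ := h.exists_eq_add_mul hd hx hd0 hx0 hdx
  have hform' : dWedge (F 1) (F 2) = dWedge (G 1) (F 2) := by
    rw [dWedge_swap (F 2), dWedge_swap (F 2) (G 1), hG1, dWedge_add_right, dWedge_add_right,
      dWedge_mul_right, dWedge_self, smul_zero, zero_add]
    simp only [← dWedgeDerivation_apply, ← algebraMap_eq, Derivation.map_algebraMap, smul_zero,
      add_zero]
  have hnot := h.lead_two_notMem hd hx hf hd0 hx0 hG1 hb
  obtain ⟨φ, a, c, hφ, hG0⟩ := h.exists_eq_add_aeval hw he hx hf hd0 hD0 hx0 hs hsd hxd hnot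
    (by rwa [hform'])
  obtain ⟨ψ, c', hψ, hφψ⟩ := exists_aeval_eq_aeval_add hd0 hD0 hsd hxd hG1 hb hφ
  obtain ⟨E₁, hE₁, hE₁0, hE₁i⟩ :=
    exists_mem_elementaryAt (k := k) (l := 0) (j := 1) (by decide) (-ψ)
  obtain ⟨E₂, hE₂, hE₂1, hE₂i⟩ :=
    exists_mem_elementaryAt (k := k) (l := 1) (j := 0) (by decide) (Polynomial.C (-e₀))
  have hψdeg : wdeg w (-Polynomial.aeval (G 1) ψ) < e := by
    rw [wdeg_neg]
    by_cases hψ0 : ψ = 0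
    · simp only [hψ0, map_zero, wdeg_zero]
      exact WithBot.bot_lt_coe e
    rw [(wdeg_aeval_and_lead_aeval hd hd0 hψ0).1, WithBot.coe_lt_coe]
    have h1 : 2 * ψ.natDegree < s := lt_of_le_of_ne hψ fun h0 => by
      rw [← h0] at hodd
      exact absurd hodd (by simp)
    have h2 := nsmul_lt_nsmul_left hd0 h1
    rw [hsd, mul_nsmul'] at h2
    exact lt_of_nsmul_lt_nsmul_right 2 h2
  have he₀ : wdeg w (C (-e₀) : MvPolynomial (Fin n) k) < d :=
    (wdeg_C_le w _).trans_lt (WithBot.coe_lt_coe.2 hd0)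
  have hA0 : comp G E₁ 0 = G 0 - Polynomial.aeval (G 1) ψ := by
    rw [comp, hE₁0, map_add, aeval_X, ← Polynomial.aeval_algHom_apply, aeval_X, map_neg,
      sub_eq_add_neg]
  have hA1 : ∀ i, i ≠ 0 → comp G E₁ i = G i := fun i hi => by rw [comp, hE₁i i hi, aeval_X]
  have hB1 : comp (comp G E₁) E₂ 1 = G 1 + C (-e₀) := by
    rw [comp, hE₂1, map_add, aeval_X, Polynomial.aeval_C, AlgHom.commutes, algebraMap_eq,
      hA1 1 (by decide)]
  have hB : ∀ i, i ≠ 1 → comp (comp G E₁) E₂ i = comp G E₁ i := fun i hi => by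
    rw [comp, hE₂i i hi, aeval_X]
  have hB0 : comp (comp G E₁) E₂ 0 = G 0 - Polynomial.aeval (G 1) ψ := by
    rw [hB 0 (by decide), hA0]
  have hB2 : comp (comp G E₁) E₂ 2 = G 2 := by rw [hB 2 (by decide), hA1 2 (by decide)]
  have hdeg0 : wdeg w (G 0 - Polynomial.aeval (G 1) ψ) = wdeg w (G 0) := by
    rw [sub_eq_add_neg, wdeg_add_eq_of_lt (by rwa [he])]
  have hlead0 : lead w (G 0 - Polynomial.aeval (G 1) ψ) = lead w (G 0) := by
    rw [sub_eq_add_neg, lead_add_of_lt (by rwa [he])]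
  have hdeg1 : wdeg w (G 1 + C (-e₀)) = wdeg w (G 1) := wdeg_add_eq_of_lt (by rwa [hd])
  have hlead1 : lead w (G 1 + C (-e₀)) = lead w (G 1) := lead_add_of_lt (by rwa [hd])
  refine ⟨E₁, hE₁, E₂, hE₂, ?_, comp_mem_triples (comp_mem_triples hG E₁) E₂, ?_⟩
  · refine Finset.sum_congr rfl fun i _ => ?_
    by_cases hi : i = 0
    · rw [hi, hA0, hdeg0]
    · rw [hA1 i hi]
  · constructor
    · refine ⟨⟨a, b, c' + c, ?_, ?_⟩, ?_⟩
      · rw [hB0, hG0, hφψ, C_add]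
        ring
      · rw [hB1, hG1, C_neg]
        ring
      · rw [hB0, hB1, hB2]
        refine Algebra.adjoin_le ?_ h.su1'.2.2
        set A := Algebra.adjoin k {G 0 - Polynomial.aeval (G 1) ψ, G 1 + C (-e₀)}
        have h1 : G 1 ∈ A := by
          have := A.add_mem (Algebra.subset_adjoin (by simp) : G 1 + C (-e₀) ∈ A)
            (A.algebraMap_mem e₀)
          rwa [algebraMap_eq, C_neg, neg_add_cancel_right] at this
        have h0 : G 0 ∈ A := by
          have := A.add_mem (Algebra.subset_adjoin (by simp) :
            G 0 - Polynomial.aeval (G 1) ψ ∈ A)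
            (Algebra.adjoin_le (Set.singleton_subset_iff.2 h1)
              (Polynomial.aeval_mem_adjoin_singleton k (G 1) (p := ψ)))
          rwa [sub_add_cancel] at this
        rintro y (rfl | rfl)
        · exact h0
        · exact h1
    · rw [hB0, hB1, hdeg0, hdeg1]
      exact ⟨h.su2'.1, hf.trans hd.symm⟩
    · rw [hB0, hB1, hlead0, hlead1]
      exact ⟨s, hodd, hs, approx_of_eq_C_mul hc₀⟩
    · rw [hB0, hB1, hlead0, hlead1, hdeg0]
      exact h.su4
    · rw [hB2]
      exact h.su5
    · rw [hB0, hB1, hB2, hdeg0, hdeg1, dWedge_sub_aeval_add_C]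
      exact h.su6

theorem SUCondition.quasiSUCondition (hw : ∀ i, 0 < w i) (hG : G ∈ triples k n)
    (h : SUCondition w F G) : QuasiSUCondition w F G := by
  obtain ⟨e, he, he0⟩ := exists_wdeg_eq_of_mem_triples hw hG 0
  obtain ⟨d, hd, hd0⟩ := exists_wdeg_eq_of_mem_triples hw hG 1
  have hG0 : G 0 ≠ 0 := fun h => by simp [h] at he
  have hG1 : G 1 ≠ 0 := fun h => by simp [h] at hd
  obtain ⟨s, hodd, hs, happ⟩ := h.su3
  have hsd : s • d = 2 • e := by
    have h0 := wdeg_pow (wdeg_lead he) 2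
    have h1 := wdeg_pow (wdeg_lead hd) s
    rw [Approx, LinearIndependent.pair_iff' (pow_ne_zero 2 (lead_ne_zero hG0))] at happ
    push Not at happ
    obtain ⟨c, hc⟩ := happ
    have hc0 : c ≠ 0 := by
      rintro rfl
      rw [zero_smul] at hc
      exact pow_ne_zero s (lead_ne_zero hG1) hc.symm
    rw [← hc, smul_eq_C_mul, wdeg_mul, h0, wdeg_C hc0, ← WithBot.coe_add, zero_add,
      WithBot.coe_inj] at h1
    exact h1.symm
  obtain ⟨⟨a, b, c, hF0, hF1⟩, hF2⟩ := h.su1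
  have hX : F 2 ∈ Algebra.adjoin k {F 1, F 2} := Algebra.subset_adjoin (by simp)
  refine ⟨⟨?_, ?_, hF2⟩, ⟨h.su2.1, h.su2.2.le⟩, ⟨?_, fun hmem => ?_⟩, h.su4, h.su5, h.su6⟩
  · rw [hF0, add_assoc, add_sub_cancel_left]
    exact Subalgebra.add_mem _ (C_mul_mem _ (Subalgebra.pow_mem _ hX 2)) (C_mul_mem _ hX)
  · rw [hF1, add_sub_cancel_left]
    exact C_mul_mem _ (Algebra.self_mem_adjoin_singleton k _)
  · rw [he, hd, WithBot.coe_lt_coe]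
    refine lt_of_nsmul_lt_nsmul_right 2 ?_
    rw [← hsd]
    exact nsmul_lt_nsmul_left hd0 (by omega)
  · obtain ⟨-, j, -, hj⟩ := eq_C_mul_pow_of_mem_adjoin (lead_isWeightedHomogeneous hd) hd0
      (lead_isWeightedHomogeneous he) (lead_ne_zero hG0) hmem
    rw [← hj, ← mul_nsmul'] at hsd
    have := (nsmul_left_strictMono hd0).injective hsd
    rw [this] at hodd
    exact absurd hodd (by simp)

theorem comp_perm_mem_triples (hF : F ∈ triples k n) (σ : Equiv.Perm (Fin 3)) :
    F ∘ σ ∈ triples k n :=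
  AlgebraicIndependent.comp hF σ σ.injective

end Main

end SU

end

theorem proposition4p3 {k : Type*} [Field k] [CharZero k] {n : ℕ} (hn : 3 ≤ n)
    {Γ : Type*} [AddCommGroup Γ] [LinearOrder Γ] [IsOrderedAddMonoid Γ] [Module.Finite ℤ Γ]
    (w : Fin n → Γ) (hw : ∀ i, 0 < w i) :
    (∀ F ∈ SU.triples k n, ∀ G ∈ SU.triples k n, SU.QuasiSUCondition w F G →
      ∃ E₁ ∈ SU.elementaryAt k 0, ∃ E₂ ∈ SU.elementaryAt k 1,
        SU.tupleDeg w (SU.comp G E₁) = SU.tupleDeg w G ∧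
        SU.comp (SU.comp G E₁) E₂ ∈ SU.triples k n ∧
        SU.SUCondition w F (SU.comp (SU.comp G E₁) E₂)) ∧
    (∀ F ∈ SU.triples k n,
      SU.AdmitsSUReduction w F ↔ SU.AdmitsQuasiSUReduction w F) := by
  refine ⟨fun F hF G hG h => h.exists_suCondition hw hF hG, fun F hF => ⟨?_, ?_⟩⟩
  · rintro ⟨G, hG, σ, h⟩
    exact ⟨G, hG, σ, h.quasiSUCondition hw (SU.comp_perm_mem_triples hG σ)⟩
  · rintro ⟨G, hG, σ, h⟩
    obtain ⟨E₁, -, E₂, -, -, hG', h'⟩ := h.exists_suCondition hw (SU.comp_perm_mem_triples hF σ)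
      (SU.comp_perm_mem_triples hG σ)
    refine ⟨SU.comp (SU.comp (G ∘ σ) E₁) E₂ ∘ σ.symm, SU.comp_perm_mem_triples hG' σ.symm, σ, ?_⟩
    rwa [Function.comp_assoc, Equiv.symm_comp_self, Function.comp_id]
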